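/- Kac infinite chain. A microstate is a pair $(x,y)\in\{0,1\}^{\mathbb Z}\times\{0,1\}^{\mathbb Z}$. The dynamics is $\varphi(x,y)(i)=(x(i-1)+y(i-1)-2x(i-1)y(i-1),\,y(i))$, and the time reversal is $\pi(x,y)(i)=(x(-i),y(-i-1))$. For a macrostate $m=(m_0,m_1)\in[-1,1]\times[0,1]$ put $\Phi(m)=((1-2m_1)m_0,m_1)$, and let $\mu_m=\mu_{(1+m_0)/2}\times\mu_{m_1}$, where $\mu_p$ is the Bernoulli measure on $\{0,1\}^{\mathbb Z}$ with $\mu_p(x(i)=1)=p$. For $t\in\mathbb N$ let $\mu_{m,t}=\mu_m\varphi^{-t}$ and $(x_t,y_t)=\varphi^t(x,y)$. Configurations $x\in\{0,1\}^{\mathbb Z}$ are read as one-sided sequences $\iota(x)=x(0)x(-1)x(1)x(-2)x(2)\dots$; $x\upharpoonright n$ denotes the first $n$ bits of $\iota(x)$, and $[\sigma]$ is the set of the configurations whose one-sided sequence begins with $\sigma$. A microstate is Martin-Löf $\mu_m$-random if the binary sequence that interleaves $\iota(x)$ and $\iota(y)$ is Martin-Löf random with respect to the image of $\mu_m$. The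 rate of irreversible information loss is $$I_{\mu_m,t}(x,y)=\limsup_{n\to\infty}-\frac1n\ln\frac{\mu_{m,t}(\pi([x_t\upharpoonright n]\times[y_t\upharpoonright n]))}{\mu_{m,t}([x_t\upharpoonright n]\times[y_t\upharpoonright n])}\in[-\infty,\infty]\qquad(\ln 0=-\infty).$$ With $m_0^N(x,y)=\frac1{2N+1}\sum_{i=-N}^N(2x(i)-1)$, $m_1^N(x,y)=\frac1{2N+1}\sum_{i=-N}^N y(i)$ and $\lambda=\mu_{1/2}$, the Boltzmann entropy is $$S_B(m)=\lim_{\delta\downarrow0}\lim_{N\to\infty}\frac1{2N+1}\ln(\lambda\times\lambda)\left(\left\{(x,y):|m_0^N(x,y)-m_0|\le\delta,\ |m_1^N(x,y)-m_1|\le\delta\right\}\right).$$ Theorem. Let $m_0\in[-1,1]$ and $m_1\in[0,1]$ be computable reals, $t\in\mathbb N$, and let $(x,y)$ be Martin-Löf $\mu_m$-random. 1. If $|m_0|<1$, then $$I_{\mu_m,t}(x,y)=\frac{1-(1-2m_1)^{2t}}{2}\,m_0\ln\frac{1+m_0}{1-m_0}.$$ 2. If $m_0\ne0$, $m_1\notin\{0,1\}$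 and $t>0$, then $I_{\mu_m,t}(x,y)>0$. 3. The limits defining $S_B(m)$ and $S_B(\Phi^t(m))$ exist and are finite, and $I_{\mu_m,t}(x,y)\ge S_B(\Phi^t(m))-S_B(m)$, with equality if and only if $m_0=0$, $m_1\in\{0,1\}$ or $t=0$. -/

import Mathlib

open MeasureTheory Filter Topology

namespace KacChain

/-! ### Computability and Martin-Löf randomness on the Cantor space -/

/-- `x` is lower semicomputable: the set of rationals below `x` is computably enumerable.
Rationals are coded as `a / (b + 1)` with `a : ℤ`, `b : ℕ`. -/
def LowerSemicomputable (x : ℝ) : Prop :=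
  REPred fun q : ℤ × ℕ => (q.1 : ℝ) / ((q.2 : ℝ) + 1) < x

/-- Computable real numbers. -/
def ComputableReal (x : ℝ) : Prop :=
  LowerSemicomputable x ∧ LowerSemicomputable (-x)

/-- The cylinder `[σ]`: the infinite binary sequences with prefix `σ`. -/
def cylinder (σ : List Bool) : Set (ℕ → Bool) :=
  {x | ∀ (i : ℕ) (h : i < σ.length), x i = σ[i]}

/-- `(U n)` is a sequence of c.e. open sets, uniformly in `n`: there are sets of strings `S n`,
c.e. uniformly in `n`, with `U n = ⋃ σ ∈ S n, [σ]`. -/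
def UniformlyCEOpen (U : ℕ → Set (ℕ → Bool)) : Prop :=
  ∃ S : ℕ → Set (List Bool),
    (REPred fun p : ℕ × List Bool => p.2 ∈ S p.1) ∧ ∀ n, U n = ⋃ σ ∈ S n, cylinder σ

/-- Martin-Löf tests with respect to `μ`. -/
def IsMLTest (μ : Measure (ℕ → Bool)) (U : ℕ → Set (ℕ → Bool)) : Prop :=
  UniformlyCEOpen U ∧ ∀ n, μ (U n) ≤ (2⁻¹ : ENNReal) ^ n

/-- Martin-Löf randomness with respect to `μ` (used for computable `μ` only). -/
def IsMLRandom (μ : Measure (ℕ → Bool)) (x : ℕ → Bool) : Prop :=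
  ∀ U : ℕ → Set (ℕ → Bool), IsMLTest μ U → x ∉ ⋂ n, U n

/-! ### Microstates and their coding by binary sequences -/

/-- Configurations on the lattice `ℤ`. -/
abbrev Config : Type := ℤ → Bool

/-- A microstate `(x, y)`: `x i` says whether the spin at `i` is up, `y i` whether there is a
scatterer at `i`. -/
abbrev Microstate : Type := Config × Config

/-- The enumeration `0, -1, 1, -2, 2, …` of `ℤ`. -/
def site (n : ℕ) : ℤ := if Even n then ((n / 2 : ℕ) : ℤ) else -(((n + 1) / 2 : ℕ) : ℤ)

/-- `ι x = x(0) x(-1) x(1) x(-2) x(2) …`. -/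
def iota (x : Config) : ℕ → Bool := fun n => x (site n)

/-- `κ (u, v) = u(0) v(0) u(1) v(1) …`. -/
def kappa (u v : ℕ → Bool) : ℕ → Bool := fun n => if Even n then u (n / 2) else v (n / 2)

/-- The binary sequence which codes a microstate. -/
def code (z : Microstate) : ℕ → Bool := kappa (iota z.1) (iota z.2)

/-- Martin-Löf randomness of a microstate with respect to a measure on microstates. -/
def IsMLRandomState (μ : Measure Microstate) (z : Microstate) : Prop :=
  IsMLRandom (μ.map code) (code z)

/-! ### Dynamics, time reversal, Gibbs measures -/

/-- One time step: a particle moves from `i - 1` to `i`, and its spin is flipped if there is a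
scatterer at `i - 1`. On bits, `a + b - 2 a b` is `xor a b`. -/
def phi (z : Microstate) : Microstate :=
  (fun i => xor (z.1 (i - 1)) (z.2 (i - 1)), z.2)

/-- Time reversal. -/
def reversal (z : Microstate) : Microstate :=
  (fun i => z.1 (-i), fun i => z.2 (-i - 1))

/-- The Bernoulli measure on `{0, 1}^ℤ` with `P(x i = 1) = p`, for `p ∈ [0, 1]`
(outside `[0, 1]`, `p` is replaced by the nearest point of `[0, 1]`). -/
noncomputable def bernoulliConfig (p : ℝ) : Measure Config :=
  Measure.infinitePi fun _ : ℤ =>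
    ProbabilityTheory.bernoulliMeasure true false (Set.projIcc (0 : ℝ) 1 zero_le_one p)

/-- The Gibbs measure `μ_m` of the macrostate `m = (m₀, m₁) ∈ [-1, 1] × [0, 1]`. -/
noncomputable def gibbs (m : ℝ × ℝ) : Measure Microstate :=
  (bernoulliConfig ((1 + m.1) / 2)).prod (bernoulliConfig m.2)

/-- The macroscopic law `Φ`. -/
def Phi (m : ℝ × ℝ) : ℝ × ℝ := ((1 - 2 * m.2) * m.1, m.2)

/-! ### Irreversible information loss -/

/-- `[x ↾ n] × [y ↾ n]`, where `x` and `y` are read as one-sided sequences through `ι`. -/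
def window (z : Microstate) (n : ℕ) : Set Microstate :=
  {w | ∀ k < n, iota w.1 k = iota z.1 k ∧ iota w.2 k = iota z.2 k}

/-- The rate of irreversible information loss at time `t` of the microstate `z`, for the initial
measure `μ`, as an extended real number (with `ln 0 = -∞`):
`limsup_n -(1/n) ln (μ_t (π ([x_t ↾ n] × [y_t ↾ n])) / μ_t ([x_t ↾ n] × [y_t ↾ n]))`
where `μ_t` is the image of `μ` under `φ^t`, and `(x_t, y_t) = φ^t z`. -/
noncomputable def infoLoss (μ : Measure Microstate) (t : ℕ) (z : Microstate) : EReal :=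
  limsup (fun n : ℕ => ((-(1 / (n : ℝ)) : ℝ) : EReal) *
    ENNReal.log (μ.map phi^[t] (reversal '' window (phi^[t] z) n) /
      μ.map phi^[t] (window (phi^[t] z) n))) atTop

/-! ### Boltzmann entropy -/

/-- The magnetization `m₀^N` over the sites `-N, …, N`. -/
noncomputable def macro0 (N : ℕ) (z : Microstate) : ℝ :=
  (∑ i ∈ Finset.Icc (-(N : ℤ)) N, (if z.1 i then (1 : ℝ) else -1)) / (2 * N + 1)

/-- The density of scatterers `m₁^N` over the sites `-N, …, N`. -/
noncomputable def macro1 (N : ℕ) (z : Microstate) : ℝ :=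
  (∑ i ∈ Finset.Icc (-(N : ℤ)) N, (if z.2 i then (1 : ℝ) else 0)) / (2 * N + 1)

/-- The Boltzmann entropy of `m` exists and equals `S`: the inner limit `N → ∞` exists for each
`δ > 0`, and the outer limit `δ ↓ 0` exists and is `S`. The values are extended real numbers, with
`ln 0 = -∞`. -/
def HasBoltzmannEntropy (m : ℝ × ℝ) (S : EReal) : Prop :=
  ∃ L : ℝ → EReal,
    (∀ δ > 0, Tendsto (fun N : ℕ => ((1 / (2 * (N : ℝ) + 1) : ℝ) : EReal) *
        ENNReal.log (((bernoulliConfig (1 / 2)).prod (bernoulliConfig (1 / 2)))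
          {z | |macro0 N z - m.1| ≤ δ ∧ |macro1 N z - m.2| ≤ δ}))
      atTop (𝓝 (L δ))) ∧
    Tendsto L (𝓝[>] 0) (𝓝 S)

end KacChain

/-!
A spin after `s` steps is the initial spin `s` sites to its left, flipped once for every occupied
scatterer it has passed, so its mean under `gibbs m` is `(1 - 2 * m.2) ^ s * m.1` and spins more
than `s` sites apart are uncorrelated. Chebyshev's inequality along the squares and an effective
Borel–Cantelli argument then give the law of large numbers for the spins of `φˢ z` along every
Martin-Löf random microstate `z`.

Since `π φᵗ π = φ⁻ᵗ`, reversing the window around `φᵗ z` amounts to observing, around the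
`t`-th iterate, the reversal of `φ²ᵗ z` in place of `z`. Both probabilities are, up to bounded
factors, products of one-site weights, and the scatterers contribute the same factor to both. The
rate of information loss is therefore the difference of the averaged log-weights of the spins of
`z` and of `φ²ᵗ z`. If `m₀ = ± 1` and the scatterers are random, then `φ²ᵗ z` contains a spin of
weight zero and the rate is infinite; if `m₁ ∈ {0, 1}`, the two probabilities coincide.

The Boltzmann entropy is a sum of binary entropies, and the comparison with the rate is the tangent
line inequality for the strictly concave binary entropy.
-/

namespace KacChain

/-! ### Binomial coefficients and binary entropy -/

lemma factorial_mul_pow_le_factorial_mul_pow_self (k j : ℕ) :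
    k.factorial * k ^ j ≤ j.factorial * k ^ k := by
  rcases le_total j k with h | h
  · obtain ⟨d, rfl⟩ := Nat.exists_eq_add_of_le h
    have hle : (j + d).factorial ≤ j.factorial * (j + d) ^ d := by
      rw [← Nat.factorial_mul_ascFactorial j d]
      exact Nat.mul_le_mul_left _ (Nat.ascFactorial_le_pow_add j d)
    calc (j + d).factorial * (j + d) ^ j ≤ j.factorial * (j + d) ^ d * (j + d) ^ j :=
          Nat.mul_le_mul_right _ hle
      _ = j.factorial * (j + d) ^ (j + d) := by ring
  · obtain ⟨d, rfl⟩ := Nat.exists_eq_add_of_le h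
    have hle : k.factorial * k ^ d ≤ (k + d).factorial :=
      (Nat.mul_le_mul_left _ (Nat.pow_le_pow_left k.le_succ d)).trans
        Nat.factorial_mul_pow_le_factorial
    calc k.factorial * k ^ (k + d) = k.factorial * k ^ d * k ^ k := by ring
      _ ≤ (k + d).factorial * k ^ k := Nat.mul_le_mul_right _ hle

lemma choose_mul_pow_mul_pow_le {M k : ℕ} (hk : k ≤ M) :
    M.choose k * (k ^ k * (M - k) ^ (M - k)) ≤ M ^ M := by
  calc M.choose k * (k ^ k * (M - k) ^ (M - k))
      = k ^ k * (M - k) ^ (M - k) * M.choose k := mul_comm _ _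
    _ ≤ ∑ j ∈ Finset.range (M + 1), k ^ j * (M - k) ^ (M - j) * M.choose j :=
        Finset.single_le_sum (f := fun j => k ^ j * (M - k) ^ (M - j) * M.choose j)
          (fun _ _ => Nat.zero_le _) (Finset.mem_range.2 (Nat.lt_succ_of_le hk))
    _ = M ^ M := by rw [← Nat.cast_id (M ^ M), ← Nat.add_sub_cancel' hk, add_pow]; simp

/-- For the binomial distribution with parameter `k / M` the most likely value is `k`. -/
lemma choose_mul_pow_mul_pow_le_choose_mul_pow_self {M k j : ℕ} (hk : k ≤ M) (hj : j ≤ M) :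
    M.choose j * (k ^ j * (M - k) ^ (M - j)) ≤ M.choose k * (k ^ k * (M - k) ^ (M - k)) := by
  have hpos : 0 < j.factorial * (M - j).factorial * (k.factorial * (M - k).factorial) := by
    positivity
  refine Nat.le_of_mul_le_mul_left ?_ hpos
  calc _ = (M.choose j * j.factorial * (M - j).factorial) *
          ((k.factorial * k ^ j) * ((M - k).factorial * (M - k) ^ (M - j))) := by ring
    _ ≤ (M.choose j * j.factorial * (M - j).factorial) *
          ((j.factorial * k ^ k) * ((M - j).factorial * (M - k) ^ (M - k))) :=
        Nat.mul_le_mul_left _ (Nat.mul_le_mul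
          (factorial_mul_pow_le_factorial_mul_pow_self k j)
          (factorial_mul_pow_le_factorial_mul_pow_self (M - k) (M - j)))
    _ = (M.choose k * k.factorial * (M - k).factorial) *
          ((j.factorial * k ^ k) * ((M - j).factorial * (M - k) ^ (M - k))) := by
        rw [Nat.choose_mul_factorial_mul_factorial hj, Nat.choose_mul_factorial_mul_factorial hk]
    _ = _ := by ring

lemma pow_self_le_succ_mul_choose_mul {M k : ℕ} (hk : k ≤ M) :
    M ^ M ≤ (M + 1) * (M.choose k * (k ^ k * (M - k) ^ (M - k))) := by
  calc M ^ M = ∑ j ∈ Finset.range (M + 1), M.choose j * (k ^ j * (M - k) ^ (M - j)) := by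
        conv_lhs => rw [← Nat.cast_id (M ^ M), ← Nat.add_sub_cancel' hk, add_pow]
        simp [Nat.add_sub_cancel' hk, mul_comm]
    _ ≤ (Finset.range (M + 1)).card • (M.choose k * (k ^ k * (M - k) ^ (M - k))) :=
        Finset.sum_le_card_nsmul _ _ _ fun j hj =>
          choose_mul_pow_mul_pow_le_choose_mul_pow_self hk
            (Nat.lt_succ_iff.1 (Finset.mem_range.1 hj))
    _ = _ := by simp

lemma log_pow_self_sub_log {M k : ℕ} (hM : 0 < M) (hk : k ≤ M) :
    Real.log ((M : ℝ) ^ M) - Real.log ((k : ℝ) ^ k * ((M - k : ℕ) : ℝ) ^ (M - k)) =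
      M * Real.binEntropy (k / M) := by
  have hM' : (M : ℝ) ≠ 0 := by positivity
  have hself (j : ℕ) : (j : ℝ) ^ j ≠ 0 := by exact_mod_cast Nat.pow_self_pos.ne'
  have mul_negMulLog (j : ℕ) :
      (M : ℝ) * ((j : ℝ) / M).negMulLog = j * Real.log M - j * Real.log j := by
    rcases j.eq_zero_or_pos with rfl | hj
    · simp
    · have : (j : ℝ) ≠ 0 := by positivity
      rw [Real.negMulLog, Real.log_div this hM']
      field_simp
      ring
  have hsub : (1 : ℝ) - k / M = ((M - k : ℕ) : ℝ) / M := by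
    rw [Nat.cast_sub hk]; field_simp
  rw [Real.log_mul (hself _) (hself _), Real.log_pow, Real.log_pow, Real.log_pow,
    Real.binEntropy_eq_negMulLog_add_negMulLog_one_sub, hsub, mul_add, mul_negMulLog,
    mul_negMulLog, Nat.cast_sub hk]
  ring

lemma log_choose_le_mul_binEntropy {M k : ℕ} (hM : 0 < M) (hk : k ≤ M) :
    Real.log (M.choose k) ≤ M * Real.binEntropy (k / M) := by
  have hc : 0 < (M.choose k : ℝ) := by exact_mod_cast Nat.choose_pos hk
  have hself (j : ℕ) : 0 < (j : ℝ) ^ j := by exact_mod_cast Nat.pow_self_pos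
  have hprod := mul_pos (hself k) (hself (M - k))
  have hle : (M.choose k : ℝ) * ((k : ℝ) ^ k * ((M - k : ℕ) : ℝ) ^ (M - k)) ≤ (M : ℝ) ^ M := by
    exact_mod_cast choose_mul_pow_mul_pow_le hk
  have hlog := Real.log_le_log (mul_pos hc hprod) hle
  rw [Real.log_mul hc.ne' hprod.ne'] at hlog
  linarith [log_pow_self_sub_log hM hk]

lemma mul_binEntropy_sub_log_le_log_choose {M k : ℕ} (hM : 0 < M) (hk : k ≤ M) :
    M * Real.binEntropy (k / M) - Real.log (M + 1) ≤ Real.log (M.choose k) := by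
  have hc : 0 < (M.choose k : ℝ) := by exact_mod_cast Nat.choose_pos hk
  have hself (j : ℕ) : 0 < (j : ℝ) ^ j := by exact_mod_cast Nat.pow_self_pos
  have hprod := mul_pos (hself k) (hself (M - k))
  have hle : (M : ℝ) ^ M ≤
      (M + 1) * ((M.choose k : ℝ) * ((k : ℝ) ^ k * ((M - k : ℕ) : ℝ) ^ (M - k))) := by
    exact_mod_cast pow_self_le_succ_mul_choose_mul hk
  have hlog := Real.log_le_log (hself M) hle
  rw [Real.log_mul (by positivity) (mul_pos hc hprod).ne', Real.log_mul hc.ne' hprod.ne'] at hlog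
  linarith [log_pow_self_sub_log hM hk]

/-- The number of binary words of length `M` whose frequency of ones is within `δ` of `p`. -/
noncomputable def typeCount (p δ : ℝ) (M : ℕ) : ℕ :=
  ∑ k ∈ Finset.range (M + 1) with |((k : ℕ) : ℝ) / M - p| ≤ δ, M.choose k

/-- The points of `[0, 1]` within `δ` of `p`. -/
def unitBall (p δ : ℝ) : Set ℝ := Set.Icc 0 1 ∩ Set.Icc (p - δ) (p + δ)

/-- The maximum of the binary entropy over `unitBall p δ`. -/
noncomputable def maxEntropy (p δ : ℝ) : ℝ := sSup (Real.binEntropy '' unitBall p δ)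

lemma exists_isMaxOn_maxEntropy {p δ : ℝ} (hp : p ∈ Set.Icc (0 : ℝ) 1) (hδ : 0 ≤ δ) :
    ∃ a ∈ unitBall p δ,
      maxEntropy p δ = Real.binEntropy a ∧ IsMaxOn Real.binEntropy (unitBall p δ) a :=
  (isCompact_Icc.inter isCompact_Icc).exists_sSup_image_eq_and_ge
    ⟨p, hp, by constructor <;> linarith⟩ Real.binEntropy_continuous.continuousOn

lemma tendsto_maxEntropy {p : ℝ} (hp : p ∈ Set.Icc (0 : ℝ) 1) :
    Tendsto (maxEntropy p) (𝓝[>] 0) (𝓝 (Real.binEntropy p)) := by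
  rw [Metric.tendsto_nhdsWithin_nhds]
  intro ε hε
  obtain ⟨η, hη, h⟩ := Metric.continuous_iff.1 Real.binEntropy_continuous p ε hε
  refine ⟨η, hη, fun {δ} hδ hdist => ?_⟩
  have hδ : 0 < δ := hδ
  rw [Real.dist_eq, sub_zero, abs_of_pos hδ] at hdist
  obtain ⟨a, ⟨-, ha⟩, hmax, -⟩ := exists_isMaxOn_maxEntropy hp hδ.le
  rw [hmax]
  refine h a ((Real.dist_eq a p).trans_lt ?_)
  exact (abs_le.2 ⟨by linarith [ha.1], by linarith [ha.2]⟩).trans_lt hdist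

/-- Rounding `a * M` towards `p * M` keeps the frequencies inside the ball. -/
lemma exists_freq_tendsto {p δ a : ℝ} (hδ : 0 < δ) (ha : a ∈ unitBall p δ) :
    ∃ k : ℕ → ℕ, (∀ M, k M ≤ M) ∧ (∀ᶠ M : ℕ in atTop, |(k M : ℝ) / M - p| ≤ δ) ∧
      Tendsto (fun M : ℕ => (k M : ℝ) / M) atTop (𝓝 a) := by
  obtain ⟨⟨ha₀, ha₁⟩, hpa, hap⟩ := ha
  have hlarge : ∀ᶠ M : ℕ in atTop, (0 : ℝ) < M ∧ 1 / (M : ℝ) ≤ δ := by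
    filter_upwards [eventually_gt_atTop 0,
      tendsto_one_div_atTop_nhds_zero_nat.eventually (eventually_le_nhds hδ)] with M hM hle
    exact ⟨by exact_mod_cast hM, hle⟩
  rcases le_total p a with hle | hle
  · refine ⟨fun M => ⌊a * M⌋₊, fun M => ?_, ?_, ?_⟩
    · exact Nat.floor_le_of_le (mul_le_of_le_one_left M.cast_nonneg ha₁)
    · filter_upwards [hlarge] with M ⟨hM, hMδ⟩
      have hfloor : (⌊a * M⌋₊ : ℝ) / M ≤ a := (div_le_iff₀ hM).2 (Nat.floor_le (by positivity))
      have hlt : a ≤ (⌊a * M⌋₊ : ℝ) / M + 1 / M := by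
        rw [← add_div, le_div_iff₀ hM]
        exact (Nat.lt_floor_add_one _).le
      exact abs_le.2 ⟨by linarith, by linarith⟩
    · exact (tendsto_nat_floor_mul_div_atTop ha₀).comp tendsto_natCast_atTop_atTop
  · refine ⟨fun M => ⌈a * M⌉₊, fun M => ?_, ?_, ?_⟩
    · exact Nat.ceil_le.2 (mul_le_of_le_one_left M.cast_nonneg ha₁)
    · filter_upwards [hlarge] with M ⟨hM, hMδ⟩
      have hceil : a ≤ (⌈a * M⌉₊ : ℝ) / M := (le_div_iff₀ hM).2 (Nat.le_ceil _)
      have hlt : (⌈a * M⌉₊ : ℝ) / M ≤ a + 1 / M := by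
        rw [div_le_iff₀ hM, add_mul, one_div_mul_cancel hM.ne']
        exact (Nat.ceil_lt_add_one (by positivity)).le
      exact abs_le.2 ⟨by linarith, by linarith⟩
    · exact (tendsto_nat_ceil_mul_div_atTop ha₀).comp tendsto_natCast_atTop_atTop

lemma tendsto_log_succ_div : Tendsto (fun M : ℕ => Real.log (M + 1) / M) atTop (𝓝 0) := by
  have hlog : (fun M : ℕ => Real.log (M + 1)) =o[atTop] fun M : ℕ => (M : ℝ) := by
    refine (Real.isLittleO_log_id_atTop.comp_tendsto
      (tendsto_atTop_add_const_right _ 1 tendsto_natCast_atTop_atTop)).trans_isBigO ?_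
    refine Asymptotics.IsBigO.of_bound 2 ?_
    filter_upwards [eventually_ge_atTop 1] with M hM
    have : (1 : ℝ) ≤ M := by exact_mod_cast hM
    simp only [Function.comp_apply, id_eq, Real.norm_eq_abs]
    rw [abs_of_pos (by positivity), abs_of_pos (by positivity)]
    linarith
  exact hlog.tendsto_div_nhds_zero

lemma choose_le_typeCount {p δ : ℝ} {M k : ℕ} (hk : k ≤ M) (hkp : |(k : ℝ) / M - p| ≤ δ) :
    M.choose k ≤ typeCount p δ M :=
  Finset.single_le_sum (f := fun k => M.choose k) (fun _ _ => Nat.zero_le _)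
    (Finset.mem_filter.2 ⟨Finset.mem_range.2 (Nat.lt_succ_of_le hk), hkp⟩)

lemma typeCount_le {p δ : ℝ} (hp : p ∈ Set.Icc (0 : ℝ) 1) (hδ : 0 ≤ δ) {M : ℕ} (hM : 0 < M) :
    (typeCount p δ M : ℝ) ≤ (M + 1) * Real.exp (M * maxEntropy p δ) := by
  obtain ⟨a, -, hmax, hle⟩ := exists_isMaxOn_maxEntropy hp hδ
  have hM' : (0 : ℝ) < M := by exact_mod_cast hM
  have hterm : ∀ k ∈ Finset.range (M + 1), |((k : ℕ) : ℝ) / M - p| ≤ δ →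
      (M.choose k : ℝ) ≤ Real.exp (M * maxEntropy p δ) := by
    intro k hk hkp
    have hk : k ≤ M := Nat.lt_succ_iff.1 (Finset.mem_range.1 hk)
    rw [abs_le] at hkp
    have hmem : (k : ℝ) / M ∈ unitBall p δ :=
      ⟨⟨by positivity, (div_le_one hM').2 (by exact_mod_cast hk)⟩, by linarith, by linarith⟩
    rw [← Real.log_le_iff_le_exp (by exact_mod_cast Nat.choose_pos hk), hmax]
    exact (log_choose_le_mul_binEntropy hM hk).trans (by gcongr; exact hle hmem)
  rw [typeCount, Nat.cast_sum, Finset.sum_filter]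
  calc _ ≤ ∑ _k ∈ Finset.range (M + 1), Real.exp (M * maxEntropy p δ) := by
        refine Finset.sum_le_sum fun _ hk => ?_
        split_ifs with hkp
        exacts [hterm _ hk hkp, (Real.exp_pos _).le]
    _ = _ := by simp

lemma eventually_typeCount_pos {p δ : ℝ} (hp : p ∈ Set.Icc (0 : ℝ) 1) (hδ : 0 < δ) :
    ∀ᶠ M in atTop, 0 < typeCount p δ M := by
  obtain ⟨k, hk, hkp, -⟩ :=
    exists_freq_tendsto hδ (a := p) ⟨hp, by linarith, by linarith⟩
  filter_upwards [hkp] with M hM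
  exact (Nat.choose_pos (hk M)).trans_le (choose_le_typeCount (hk M) hM)

lemma tendsto_log_typeCount_div {p δ : ℝ} (hp : p ∈ Set.Icc (0 : ℝ) 1) (hδ : 0 < δ) :
    Tendsto (fun M : ℕ => Real.log (typeCount p δ M) / M) atTop (𝓝 (maxEntropy p δ)) := by
  obtain ⟨a, ha, hmax, -⟩ := exists_isMaxOn_maxEntropy hp hδ.le
  obtain ⟨k, hk, hkp, hka⟩ := exists_freq_tendsto hδ ha
  have hlower : Tendsto (fun M : ℕ => Real.binEntropy ((k M : ℝ) / M) - Real.log (M + 1) / M)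
      atTop (𝓝 (maxEntropy p δ)) := by
    simpa [hmax] using
      ((Real.binEntropy_continuous.tendsto a).comp hka).sub tendsto_log_succ_div
  have hupper : Tendsto (fun M : ℕ => Real.log (M + 1) / M + maxEntropy p δ)
      atTop (𝓝 (maxEntropy p δ)) := by
    simpa using tendsto_log_succ_div.add_const (maxEntropy p δ)
  refine tendsto_of_tendsto_of_tendsto_of_le_of_le' hlower hupper ?_ ?_
  · filter_upwards [hkp, eventually_gt_atTop 0] with M hM hM₀
    have hM₀' : (0 : ℝ) < M := by exact_mod_cast hM₀
    have hlog : Real.log (M.choose (k M)) ≤ Real.log (typeCount p δ M) :=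
      Real.log_le_log (by exact_mod_cast Nat.choose_pos (hk M))
        (by exact_mod_cast choose_le_typeCount (hk M) hM)
    rw [le_div_iff₀ hM₀', sub_mul, div_mul_cancel₀ _ hM₀'.ne']
    linarith [mul_binEntropy_sub_log_le_log_choose hM₀ (hk M)]
  · filter_upwards [eventually_typeCount_pos hp hδ, eventually_gt_atTop 0] with M hM hM₀
    have hM₀' : (0 : ℝ) < M := by exact_mod_cast hM₀
    have hlog := Real.log_le_log (by exact_mod_cast hM) (typeCount_le hp hδ.le hM₀)
    rw [Real.log_mul (by positivity) (Real.exp_pos _).ne', Real.log_exp] at hlog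
    rw [div_le_iff₀ hM₀', add_mul, div_mul_cancel₀ _ hM₀'.ne']
    linarith

/-! ### Bernoulli measures -/

/-- The probability of the bit `b` when `true` has probability `p`. -/
def weight (p : ℝ) (b : Bool) : ℝ := if b then p else 1 - p

lemma weight_nonneg {p : ℝ} (hp : p ∈ Set.Icc (0 : ℝ) 1) (b : Bool) : 0 ≤ weight p b := by
  obtain ⟨hp₀, hp₁⟩ := hp
  cases b <;> simp [weight, hp₀, hp₁]

/-- The factor of `bernoulliConfig p` at a single site. -/
noncomputable def bernoulliBool (p : ℝ) : Measure Bool :=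
  ProbabilityTheory.bernoulliMeasure true false (Set.projIcc (0 : ℝ) 1 zero_le_one p)

instance (p : ℝ) : IsProbabilityMeasure (bernoulliBool p) := by
  unfold bernoulliBool; infer_instance

lemma bernoulliConfig_eq_infinitePi (p : ℝ) :
    bernoulliConfig p = Measure.infinitePi fun _ : ℤ => bernoulliBool p := rfl

instance (p : ℝ) : IsProbabilityMeasure (bernoulliConfig p) := by
  rw [bernoulliConfig_eq_infinitePi]; infer_instance

instance (m : ℝ × ℝ) : IsProbabilityMeasure (gibbs m) := by
  unfold gibbs; infer_instance

lemma bernoulliBool_singleton {p : ℝ} (hp : p ∈ Set.Icc (0 : ℝ) 1) (b : Bool) :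
    bernoulliBool p {b} = ENNReal.ofReal (weight p b) := by
  rw [← ofReal_measureReal, bernoulliBool,
    ProbabilityTheory.bernoulliMeasure_real_apply _ (measurableSet_singleton b),
    Set.projIcc_of_mem _ hp]
  cases b <;> simp [weight]

lemma setOf_eqOn_eq_pi (W : Finset ℤ) (x : Config) :
    {u : Config | ∀ i ∈ W, u i = x i} = (W : Set ℤ).pi fun i => {x i} := by
  ext; simp [Set.mem_pi]

lemma measurableSet_setOf_eqOn (W : Finset ℤ) (x : Config) :
    MeasurableSet {u : Config | ∀ i ∈ W, u i = x i} := by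
  rw [setOf_eqOn_eq_pi]
  exact MeasurableSet.pi W.countable_toSet fun _ _ => measurableSet_singleton _

lemma bernoulliConfig_setOf_eqOn {p : ℝ} (hp : p ∈ Set.Icc (0 : ℝ) 1) (W : Finset ℤ)
    (x : Config) :
    bernoulliConfig p {u | ∀ i ∈ W, u i = x i} =
      ENNReal.ofReal (∏ i ∈ W, weight p (x i)) := by
  rw [setOf_eqOn_eq_pi, bernoulliConfig_eq_infinitePi,
    Measure.infinitePi_pi _ (fun _ _ => measurableSet_singleton _),
    ENNReal.ofReal_prod_of_nonneg (fun _ _ => weight_nonneg hp _)]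
  exact Finset.prod_congr rfl fun _ _ => bernoulliBool_singleton hp _

/-- The sign `(-1) ^ b` of a bit; it turns `xor` into a product. The spin of a particle with
bit `b` is `-sgn b`. -/
def sgn (b : Bool) : ℝ := if b then -1 else 1

lemma sgn_xor (a b : Bool) : sgn (xor a b) = sgn a * sgn b := by
  cases a <;> cases b <;> simp [sgn]

lemma abs_sgn (b : Bool) : |sgn b| = 1 := by cases b <;> simp [sgn]

lemma integral_sgn {p : ℝ} (hp : p ∈ Set.Icc (0 : ℝ) 1) :
    ∫ b, sgn b ∂bernoulliBool p = 1 - 2 * p := by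
  rw [integral_fintype Integrable.of_finite]
  simp only [Fintype.sum_bool, measureReal_def, bernoulliBool_singleton hp,
    ENNReal.toReal_ofReal (weight_nonneg hp _)]
  simp [weight, sgn]; ring

lemma integral_prod_sgn {p : ℝ} (hp : p ∈ Set.Icc (0 : ℝ) 1) (A : Finset ℤ) :
    ∫ x, ∏ i ∈ A, sgn (x i) ∂bernoulliConfig p = (1 - 2 * p) ^ A.card := by
  have hrestrict (x : Config) : ∏ i ∈ A, sgn (x i) = ∏ i : A, sgn (A.restrict x i) :=
    (Finset.prod_coe_sort A fun i => sgn (x i)).symm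
  rw [bernoulliConfig_eq_infinitePi, integral_congr_ae (ae_of_all _ hrestrict),
    integral_restrict_infinitePi (μ := fun _ : ℤ => bernoulliBool p)
      (f := fun y : A → Bool => ∏ i, sgn (y i)) Measurable.of_discrete.aestronglyMeasurable,
    integral_fintype_prod_eq_prod (f := fun _ b => sgn b)]
  simp [integral_sgn hp]

/-- The sites of `I` at which `x` has a one. -/
def ones (I : Finset ℤ) (x : Config) : Finset ℤ := {i ∈ I | x i}

lemma preimage_ones_singleton {I A : Finset ℤ} (hA : A ⊆ I) :
    ones I ⁻¹' {A} = {x : Config | ∀ i ∈ I, x i = decide (i ∈ A)} := by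
  ext x
  simp only [ones, Set.mem_preimage, Set.mem_singleton_iff, Finset.ext_iff, Finset.mem_filter,
    Set.mem_ofPred_eq]
  refine forall_congr' fun i => ?_
  by_cases hi : i ∈ I
  · cases x i <;> simp [hi]
  · simpa [hi] using fun h => hi (hA h)

lemma bernoulliConfig_preimage_ones_singleton {p : ℝ} (hp : p ∈ Set.Icc (0 : ℝ) 1)
    {I A : Finset ℤ} (hA : A ⊆ I) :
    bernoulliConfig p (ones I ⁻¹' {A}) =
      ENNReal.ofReal (p ^ A.card * (1 - p) ^ (I.card - A.card)) := by
  rw [preimage_ones_singleton hA, bernoulliConfig_setOf_eqOn hp I fun i => decide (i ∈ A)]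
  simp only [weight, decide_eq_true_eq, Finset.prod_ite, Finset.prod_const]
  rw [Finset.filter_mem_eq_inter, Finset.inter_eq_right.2 hA, Finset.filter_notMem_eq_sdiff,
    Finset.card_sdiff_of_subset hA]

lemma bernoulliConfig_setOf_card_ones {p : ℝ} (hp : p ∈ Set.Icc (0 : ℝ) 1) (I : Finset ℤ)
    (P : ℕ → Prop) [DecidablePred P] :
    bernoulliConfig p {x | P (ones I x).card} = ENNReal.ofReal
      (∑ k ∈ Finset.range (I.card + 1) with P k,
        I.card.choose k * (p ^ k * (1 - p) ^ (I.card - k))) := by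
  have hp' : 0 ≤ 1 - p := sub_nonneg.2 hp.2
  have hp₀ : 0 ≤ p := hp.1
  have hpre : {x : Config | P (ones I x).card} =
      ones I ⁻¹' ({A ∈ I.powerset | P A.card} : Finset (Finset ℤ)) := by
    ext x
    simp [ones]
  have hsub {A : Finset ℤ} (hA : A ∈ ({A ∈ I.powerset | P A.card} : Finset _)) : A ⊆ I :=
    Finset.mem_powerset.1 (Finset.mem_filter.1 hA).1
  rw [hpre, ← sum_measure_preimage_singleton _ fun A hA => by
      rw [preimage_ones_singleton (hsub hA)]
      exact measurableSet_setOf_eqOn I fun i => decide (i ∈ A),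
    Finset.sum_congr rfl fun A hA => bernoulliConfig_preimage_ones_singleton hp (hsub hA),
    ← ENNReal.ofReal_sum_of_nonneg fun _ _ => by positivity, Finset.sum_filter,
    Finset.sum_powerset_apply_card
      fun k => if P k then p ^ k * (1 - p) ^ (I.card - k) else 0, Finset.sum_filter]
  simp

/-! ### Boltzmann entropy of a Bernoulli macrostate -/

lemma card_Icc_neg_self (N : ℕ) : (Finset.Icc (-(N : ℤ)) N).card = 2 * N + 1 := by
  rw [Int.card_Icc]; omega

lemma macro1_eq_card_ones_div (N : ℕ) (z : Microstate) :
    macro1 N z = ((ones (Finset.Icc (-(N : ℤ)) N) z.2).card : ℝ) / (2 * N + 1 : ℕ) := by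
  rw [macro1, ones, Finset.card_filter]
  push_cast
  rfl

lemma macro0_eq_card_ones_div (N : ℕ) (z : Microstate) :
    macro0 N z = 2 * (((ones (Finset.Icc (-(N : ℤ)) N) z.1).card : ℝ) / (2 * N + 1 : ℕ)) - 1 := by
  have hspin (b : Bool) : (if b then (1 : ℝ) else -1) = 2 * (if b then 1 else 0) - 1 := by
    cases b <;> norm_num
  simp only [macro0, hspin, Finset.sum_sub_distrib, ← Finset.mul_sum, Finset.sum_const,
    card_Icc_neg_self, nsmul_eq_mul, ones, Finset.card_filter]
  push_cast
  field_simp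

lemma bernoulliConfig_half_freq (p δ : ℝ) (N : ℕ) :
    bernoulliConfig (1 / 2)
        {x | |((ones (Finset.Icc (-(N : ℤ)) N) x).card : ℝ) / (2 * N + 1 : ℕ) - p| ≤ δ} =
      ENNReal.ofReal (typeCount p δ (2 * N + 1) / 2 ^ (2 * N + 1)) := by
  have hlaw := bernoulliConfig_setOf_card_ones (p := 1 / 2) ⟨by norm_num, by norm_num⟩
    (Finset.Icc (-(N : ℤ)) N) fun k => |(k : ℝ) / (2 * N + 1 : ℕ) - p| ≤ δ
  rw [card_Icc_neg_self] at hlaw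
  rw [hlaw, typeCount, Nat.cast_sum, Finset.sum_div]
  refine congrArg _ (Finset.sum_congr rfl fun k hk => ?_)
  have hk : k ≤ 2 * N + 1 := Nat.lt_succ_iff.1 (Finset.mem_range.1 (Finset.mem_filter.1 hk).1)
  rw [show (1 : ℝ) - 1 / 2 = 1 / 2 by norm_num, ← pow_add, Nat.add_sub_cancel' hk]
  simp [div_eq_mul_inv]

lemma half_prod_half_setOf_macro (m : ℝ × ℝ) (δ : ℝ) (N : ℕ) :
    (bernoulliConfig (1 / 2)).prod (bernoulliConfig (1 / 2))
        {z | |macro0 N z - m.1| ≤ δ ∧ |macro1 N z - m.2| ≤ δ} =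
      ENNReal.ofReal (typeCount ((1 + m.1) / 2) (δ / 2) (2 * N + 1) / 2 ^ (2 * N + 1)) *
        ENNReal.ofReal (typeCount m.2 δ (2 * N + 1) / 2 ^ (2 * N + 1)) := by
  rw [← bernoulliConfig_half_freq, ← bernoulliConfig_half_freq, ← Measure.prod_prod]
  congr 1
  ext z
  simp only [Set.mem_ofPred_eq, Set.mem_prod, macro0_eq_card_ones_div, macro1_eq_card_ones_div]
  refine and_congr_left fun _ => ?_
  rw [abs_le, abs_le]
  constructor <;> rintro ⟨h₁, h₂⟩ <;> constructor <;> linarith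

lemma tendsto_log_half_prod_half_setOf_macro {m : ℝ × ℝ}
    (hp : (1 + m.1) / 2 ∈ Set.Icc (0 : ℝ) 1) (hm : m.2 ∈ Set.Icc (0 : ℝ) 1) {δ : ℝ} (hδ : 0 < δ) :
    Tendsto (fun N : ℕ => ((1 / (2 * (N : ℝ) + 1) : ℝ) : EReal) *
        ENNReal.log ((bernoulliConfig (1 / 2)).prod (bernoulliConfig (1 / 2))
          {z | |macro0 N z - m.1| ≤ δ ∧ |macro1 N z - m.2| ≤ δ})) atTop
      (𝓝 ((maxEntropy ((1 + m.1) / 2) (δ / 2) + maxEntropy m.2 δ - 2 * Real.log 2 : ℝ) :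
        EReal)) := by
  have hodd : Tendsto (fun N : ℕ => 2 * N + 1) atTop atTop :=
    tendsto_atTop_mono (fun N => by rw [id]; omega) tendsto_id
  have hlim := (((tendsto_log_typeCount_div hp (half_pos hδ)).add
    (tendsto_log_typeCount_div hm hδ)).sub_const (2 * Real.log 2)).comp hodd
  refine Tendsto.congr' ?_ ((continuous_coe_real_ereal.tendsto _).comp hlim)
  filter_upwards [hodd.eventually (eventually_typeCount_pos hp (half_pos hδ)),
    hodd.eventually (eventually_typeCount_pos hm hδ)] with N hN₀ hN₁
  rw [half_prod_half_setOf_macro, ← ENNReal.ofReal_mul (by positivity),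
    ENNReal.log_ofReal_of_pos (by positivity), ← EReal.coe_mul, Function.comp_apply,
    Function.comp_apply, Real.log_mul (by positivity) (by positivity),
    Real.log_div (by positivity) (by positivity), Real.log_div (by positivity) (by positivity),
    Real.log_pow]
  congr 1
  push_cast
  field_simp
  ring

/-- The Boltzmann entropy of the macrostate `m`, in closed form: the sum of the entropies of the two
Bernoulli factors of `gibbs m`, normalized so that the maximal value is `0`. -/
noncomputable def boltzmannEntropy (m : ℝ × ℝ) : ℝ :=
  Real.binEntropy ((1 + m.1) / 2) + Real.binEntropy m.2 - 2 * Real.log 2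

lemma half_one_add_mem_Icc {m₀ : ℝ} (hm₀ : m₀ ∈ Set.Icc (-1 : ℝ) 1) :
    (1 + m₀) / 2 ∈ Set.Icc (0 : ℝ) 1 := by
  obtain ⟨_, _⟩ := hm₀
  constructor <;> linarith

theorem hasBoltzmannEntropy {m : ℝ × ℝ} (hm₀ : m.1 ∈ Set.Icc (-1 : ℝ) 1)
    (hm₁ : m.2 ∈ Set.Icc (0 : ℝ) 1) :
    HasBoltzmannEntropy m (boltzmannEntropy m) := by
  have hp := half_one_add_mem_Icc hm₀
  refine ⟨_, fun δ hδ => tendsto_log_half_prod_half_setOf_macro hp hm₁ hδ,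
    (continuous_coe_real_ereal.tendsto _).comp ?_⟩
  have hhalf : Tendsto (fun δ : ℝ => δ / 2) (𝓝[>] 0) (𝓝[>] 0) := by
    refine tendsto_nhdsWithin_iff.2
      ⟨?_, eventually_mem_nhdsWithin.mono fun _ hδ => half_pos (Set.mem_Ioi.1 hδ)⟩
    simpa using ((continuous_id.div_const (2 : ℝ)).tendsto 0).mono_left nhdsWithin_le_nhds
  exact (((tendsto_maxEntropy hp).comp hhalf).add (tendsto_maxEntropy hm₁)).sub_const _

/-! ### Effective laws of large numbers -/

lemma primrec_two_pow : Primrec fun n : ℕ => 2 ^ n := by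
  have hrec : Primrec fun n : ℕ => (Nat.rec 1 (fun _ c => 2 * c) n : ℕ) :=
    Primrec.nat_rec₁ 1 (Primrec.nat_mul.comp (Primrec.const 2) Primrec.snd)
  refine hrec.of_eq fun n => ?_
  induction n with
  | zero => rfl
  | succ n ih => rw [pow_succ, ← ih]; exact mul_comm _ _

/-- The first `n` bits of a sequence. -/
def prefixList (u : ℕ → Bool) (n : ℕ) : List Bool := (List.range n).map u

@[simp]
lemma length_prefixList (u : ℕ → Bool) (n : ℕ) : (prefixList u n).length = n := by
  simp [prefixList]

lemma getD_prefixList (u : ℕ → Bool) {i n : ℕ} (hi : i < n) :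
    (prefixList u n).getD i false = u i := by
  simp [prefixList, hi]

lemma mem_cylinder_iff {u : ℕ → Bool} {σ : List Bool} :
    u ∈ cylinder σ ↔ σ = prefixList u σ.length := by
  refine ⟨fun hu => List.ext_getElem (by simp) fun i hi _ => ?_, fun hσ i hi => ?_⟩
  · simp [prefixList, hu i hi]
  · simp only [List.getElem_of_eq hσ hi, prefixList, List.getElem_map, List.getElem_range]

lemma tsum_ofReal_div_sq_le {B : ℝ} (hB : 0 ≤ B) (a : ℕ) :
    ∑' i : ℕ, ENNReal.ofReal (B / ((a + 1 + i : ℕ) : ℝ) ^ 2) ≤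
      ENNReal.ofReal (2 * B / (a + 1)) := by
  refine ENNReal.tsum_le_of_sum_range_le fun m => ?_
  rw [← ENNReal.ofReal_sum_of_nonneg fun _ _ => by positivity]
  refine ENNReal.ofReal_le_ofReal ?_
  calc ∑ i ∈ Finset.range m, B / ((a + 1 + i : ℕ) : ℝ) ^ 2
      = B * ∑ i ∈ Finset.Ioo a (a + 1 + m), ((i : ℝ) ^ 2)⁻¹ := by
        rw [← Finset.Ico_add_one_left_eq_Ioo, Finset.sum_Ico_eq_sum_range, Finset.mul_sum,
          Nat.add_sub_cancel_left]
        rfl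
    _ ≤ B * (2 / (a + 1)) := mul_le_mul_of_nonneg_left (sum_Ioo_inv_sq_le a _) hB
    _ = 2 * B / (a + 1) := by ring

/-- The strings of length `ℓ k` with property `P k` for some `k > K * 2 ^ n`. -/
def largeStrings (P : ℕ → List Bool → Prop) (ℓ : ℕ → ℕ) (K n : ℕ) : Set (List Bool) :=
  {σ | ∃ k ∈ List.range (σ.length + 1), K * 2 ^ n < k ∧ σ.length = ℓ k ∧ P k σ}

section LargeStrings

variable {P : ℕ → List Bool → Prop} {ℓ : ℕ → ℕ}

lemma rePred_largeStrings (hP : PrimrecRel P) (hℓ : Primrec ℓ) (K : ℕ) :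
    REPred fun p : ℕ × List Bool => p.2 ∈ largeStrings P ℓ K p.1 := by
  refine (PrimrecPred.computablePred ?_).to_re
  have hrel : PrimrecRel fun (k : ℕ) (p : ℕ × List Bool) =>
      K * 2 ^ p.1 < k ∧ p.2.length = ℓ k ∧ P k p.2 := by
    have hσ : Primrec fun q : ℕ × ℕ × List Bool => q.2.2 := Primrec.snd.comp Primrec.snd
    exact (Primrec.nat_lt.comp (Primrec.nat_mul.comp (Primrec.const K)
      (primrec_two_pow.comp (Primrec.fst.comp Primrec.snd))) Primrec.fst).and
      ((Primrec.eq.comp (Primrec.list_length.comp hσ) (hℓ.comp Primrec.fst)).and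
        (hP.comp Primrec.fst hσ))
  exact hrel.exists_mem_list.comp (Primrec.list_range.comp
    (Primrec.succ.comp (Primrec.list_length.comp Primrec.snd))) Primrec.id

lemma mem_iUnion_cylinder_largeStrings (hle : ∀ k, k ≤ ℓ k) {K n : ℕ} {v : ℕ → Bool} :
    v ∈ ⋃ σ ∈ largeStrings P ℓ K n, cylinder σ ↔ ∃ k > K * 2 ^ n, P k (prefixList v (ℓ k)) := by
  simp only [Set.mem_iUnion, exists_prop]
  constructor
  · rintro ⟨σ, ⟨k, -, hk, hlen, hPσ⟩, hv⟩
    rw [mem_cylinder_iff, hlen] at hv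
    exact ⟨k, hk, hv ▸ hPσ⟩
  · rintro ⟨k, hk, hPk⟩
    exact ⟨prefixList v (ℓ k), ⟨k, by simpa [Nat.lt_succ_iff] using hle k, hk, by simp, hPk⟩,
      mem_cylinder_iff.2 (by simp)⟩

lemma measure_iUnion_cylinder_largeStrings_le (hle : ∀ k, k ≤ ℓ k) {ν : Measure (ℕ → Bool)}
    {B : ℝ} (hB : 0 ≤ B) {K : ℕ} (hK : 2 * B ≤ K)
    (hν : ∀ k : ℕ, 0 < k → ν {v | P k (prefixList v (ℓ k))} ≤ ENNReal.ofReal (B / k ^ 2))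
    (n : ℕ) : ν (⋃ σ ∈ largeStrings P ℓ K n, cylinder σ) ≤ 2⁻¹ ^ n := by
  have hsub : (⋃ σ ∈ largeStrings P ℓ K n, cylinder σ) ⊆
      ⋃ i : ℕ, {v | P (K * 2 ^ n + 1 + i) (prefixList v (ℓ (K * 2 ^ n + 1 + i)))} := by
    intro v hv
    obtain ⟨k, hk, hPk⟩ := (mem_iUnion_cylinder_largeStrings hle).1 hv
    obtain ⟨i, rfl⟩ := Nat.exists_eq_add_of_le (Nat.succ_le_of_lt hk)
    exact Set.mem_iUnion.2 ⟨i, hPk⟩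
  calc ν (⋃ σ ∈ largeStrings P ℓ K n, cylinder σ)
      ≤ ∑' i : ℕ, ENNReal.ofReal (B / ((K * 2 ^ n + 1 + i : ℕ) : ℝ) ^ 2) :=
        (measure_mono hsub).trans ((measure_iUnion_le _).trans
          (ENNReal.tsum_le_tsum fun i => hν _ (by omega)))
    _ ≤ ENNReal.ofReal (2 * B / ((K * 2 ^ n : ℕ) + 1)) := tsum_ofReal_div_sq_le hB _
    _ ≤ ENNReal.ofReal (2⁻¹ ^ n) := by
        refine ENNReal.ofReal_le_ofReal ?_
        rw [inv_pow, ← one_div, div_le_div_iff₀ (by positivity) (by positivity)]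
        push_cast
        nlinarith [mul_le_mul_of_nonneg_right hK (by positivity : (0 : ℝ) ≤ 2 ^ n)]
    _ = 2⁻¹ ^ n := by
        rw [ENNReal.ofReal_pow (by norm_num), ENNReal.ofReal_inv_of_pos two_pos,
          ENNReal.ofReal_ofNat]

/-- Effective Borel–Cantelli: the strings that occur after stage `K * 2 ^ n` form the `n`-th level
of a Martin-Löf test. -/
lemma IsMLRandom.eventually_not {ν : Measure (ℕ → Bool)} {u : ℕ → Bool} (hu : IsMLRandom ν u)
    (hP : PrimrecRel P) (hℓ : Primrec ℓ) (hle : ∀ k, k ≤ ℓ k) {B : ℝ} (hB : 0 ≤ B)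
    (hν : ∀ k : ℕ, 0 < k → ν {v | P k (prefixList v (ℓ k))} ≤ ENNReal.ofReal (B / k ^ 2)) :
    ∀ᶠ k in atTop, ¬ P k (prefixList u (ℓ k)) := by
  obtain ⟨K, hK⟩ := exists_nat_ge (2 * B)
  have hnot := hu _ ⟨⟨_, rePred_largeStrings hP hℓ K, fun _ => rfl⟩,
    measure_iUnion_cylinder_largeStrings_le hle hB hK hν⟩
  simp only [Set.mem_iInter, not_forall] at hnot
  obtain ⟨n, hn⟩ := hnot
  filter_upwards [eventually_gt_atTop (K * 2 ^ n)] with k hk hPk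
  exact hn ((mem_iUnion_cylinder_largeStrings hle).2 ⟨k, hk, hPk⟩)

end LargeStrings

lemma IsMLRandom.measure_cylinder_ne_zero {ν : Measure (ℕ → Bool)} {u : ℕ → Bool}
    (hu : IsMLRandom ν u) (n : ℕ) : ν (cylinder (prefixList u n)) ≠ 0 := by
  intro hzero
  refine hu (fun _ => ⋃ σ ∈ ({prefixList u n} : Set (List Bool)), cylinder σ)
    ⟨⟨fun _ => {prefixList u n}, ?_, fun _ => rfl⟩, fun _ => by simp [hzero]⟩ ?_
  · exact (PrimrecPred.computablePred
      (Primrec.eq.comp Primrec.snd (Primrec.const (prefixList u n)))).to_re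
  · simp [mem_cylinder_iff]

section LawOfLargeNumbers

variable {ν : Measure (ℕ → Bool)} [IsProbabilityMeasure ν] {u : ℕ → Bool}
  {S : (ℕ → Bool) → ℕ → ℕ} {T : List Bool → ℕ → ℕ} {ℓ : ℕ → ℕ} {ρ C : ℝ}

lemma IsMLRandom.eventually_not_of_deviation (hu : IsMLRandom ν u) (hT : Primrec₂ T)
    (hℓ : Primrec ℓ) (hle : ∀ k, k ≤ ℓ k) (hST : ∀ v N, T (prefixList v (ℓ N)) N = S v N)
    (hmem : ∀ N, MemLp (fun v => (S v N : ℝ)) 2 ν) (hmean : ∀ N, ∫ v, (S v N : ℝ) ∂ν = ρ * N)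
    (hC : 0 ≤ C) (hvar : ∀ N, ProbabilityTheory.variance (fun v => (S v N : ℝ)) ν ≤ C * N)
    {R : ℕ → ℕ → Prop} (hR : PrimrecRel R) {η : ℝ} (hη : 0 < η)
    (hdev : ∀ k c, R k c → η * (k : ℝ) ^ 2 ≤ |(c : ℝ) - ρ * (k : ℝ) ^ 2|) :
    ∀ᶠ k in atTop, ¬ R k (S u (k ^ 2)) := by
  have hsq : Primrec fun k : ℕ => k ^ 2 :=
    (Primrec.nat_mul.comp Primrec.id Primrec.id).of_eq fun k => (sq k).symm
  have hP : PrimrecRel fun (k : ℕ) (σ : List Bool) => R k (T σ (k ^ 2)) :=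
    hR.comp Primrec.fst (hT.comp Primrec.snd (hsq.comp Primrec.fst))
  have hev := hu.eventually_not hP (hℓ.comp hsq)
    (fun k => (Nat.le_self_pow two_ne_zero k).trans (hle _)) (B := C / η ^ 2) (by positivity)
    fun k hk => ?_
  · simpa only [hST] using hev
  have : (0 : ℝ) < k := by exact_mod_cast hk
  simp only [hST]
  calc ν {v | R k (S v (k ^ 2))}
      ≤ ν {v | η * (k : ℝ) ^ 2 ≤ |(S v (k ^ 2) : ℝ) - ∫ v, (S v (k ^ 2) : ℝ) ∂ν|} := by
        refine measure_mono fun v hv => ?_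
        simpa only [hmean, Nat.cast_pow, Set.mem_ofPred_eq] using hdev k _ hv
    _ ≤ ENNReal.ofReal
          (ProbabilityTheory.variance (fun v => (S v (k ^ 2) : ℝ)) ν / (η * (k : ℝ) ^ 2) ^ 2) :=
        ProbabilityTheory.meas_ge_le_variance_div_sq (hmem _) (by positivity)
    _ ≤ ENNReal.ofReal (C * (k ^ 2 : ℕ) / (η * (k : ℝ) ^ 2) ^ 2) := by gcongr; exact hvar _
    _ = ENNReal.ofReal (C / η ^ 2 / k ^ 2) := by
        congr 1
        push_cast
        field_simp

lemma exists_natCast_div_btwn {x y : ℝ} (hx : 0 ≤ x) (hxy : x < y) :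
    ∃ a b : ℕ, 0 < b ∧ x < (a : ℝ) / b ∧ (a : ℝ) / b < y := by
  obtain ⟨q, hxq, hqy⟩ := exists_rat_btwn hxy
  obtain ⟨a, ha⟩ := Int.eq_ofNat_of_zero_le (Rat.num_nonneg.2 (by exact_mod_cast hx.trans hxq.le))
  rw [Rat.cast_def, ha, Int.cast_natCast] at hxq hqy
  exact ⟨a, q.den, q.den_pos, hxq, hqy⟩

lemma primrecRel_mul_lt_mul_sq (a b : ℕ) :
    PrimrecRel fun k c : ℕ => b * c < a * (k * k) :=
  Primrec.nat_lt.comp (Primrec.nat_mul.comp (Primrec.const b) Primrec.snd)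
    (Primrec.nat_mul.comp (Primrec.const a) (Primrec.nat_mul.comp Primrec.fst Primrec.fst))

lemma primrecRel_mul_sq_lt_mul (a b : ℕ) :
    PrimrecRel fun k c : ℕ => a * (k * k) < b * c :=
  Primrec.nat_lt.comp
    (Primrec.nat_mul.comp (Primrec.const a) (Primrec.nat_mul.comp Primrec.fst Primrec.fst))
    (Primrec.nat_mul.comp (Primrec.const b) Primrec.snd)

lemma IsMLRandom.tendsto_sq_div_sq (hu : IsMLRandom ν u) (hT : Primrec₂ T)
    (hℓ : Primrec ℓ) (hle : ∀ k, k ≤ ℓ k) (hST : ∀ v N, T (prefixList v (ℓ N)) N = S v N)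
    (hmem : ∀ N, MemLp (fun v => (S v N : ℝ)) 2 ν) (hmean : ∀ N, ∫ v, (S v N : ℝ) ∂ν = ρ * N)
    (hC : 0 ≤ C) (hvar : ∀ N, ProbabilityTheory.variance (fun v => (S v N : ℝ)) ν ≤ C * N) :
    Tendsto (fun k : ℕ => (S u (k ^ 2) : ℝ) / (k ^ 2 : ℕ)) atTop (𝓝 ρ) := by
  have hρ : 0 ≤ ρ := by
    have := hmean 1
    rw [Nat.cast_one, mul_one] at this
    exact this ▸ integral_nonneg fun _ => Nat.cast_nonneg _
  refine tendsto_order.2 ⟨fun x hx => ?_, fun x hx => ?_⟩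
  · rcases lt_or_ge x 0 with hneg | hnonneg
    · exact Eventually.of_forall fun k => hneg.trans_le (by positivity)
    obtain ⟨a, b, hb, hxab, habρ⟩ := exists_natCast_div_btwn hnonneg hx
    have hb' : (0 : ℝ) < b := by exact_mod_cast hb
    have hev := hu.eventually_not_of_deviation hT hℓ hle hST hmem hmean hC hvar
      (primrecRel_mul_lt_mul_sq a b) (sub_pos.2 habρ) fun k c hkc => ?_
    · filter_upwards [hev, eventually_gt_atTop 0] with k hk hk₀
      refine hxab.trans_le ((div_le_div_iff₀ hb' (by positivity)).2 ?_)
      rw [not_lt, ← sq, mul_comm b] at hk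
      exact_mod_cast hk
    · have hkc : (b : ℝ) * c < a * (k : ℝ) ^ 2 := by rw [sq]; exact_mod_cast hkc
      have : (c : ℝ) < a / b * k ^ 2 := by
        rwa [div_mul_eq_mul_div, lt_div_iff₀ hb', mul_comm]
      rw [abs_sub_comm]
      exact le_trans (by linarith) (le_abs_self _)
  · obtain ⟨a, b, hb, hρab, habx⟩ := exists_natCast_div_btwn hρ hx
    have hb' : (0 : ℝ) < b := by exact_mod_cast hb
    have hev := hu.eventually_not_of_deviation hT hℓ hle hST hmem hmean hC hvar
      (primrecRel_mul_sq_lt_mul a b) (sub_pos.2 hρab) fun k c hkc => ?_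
    · filter_upwards [hev, eventually_gt_atTop 0] with k hk hk₀
      refine ((div_le_div_iff₀ (by positivity) hb').2 ?_).trans_lt habx
      rw [not_lt, ← sq, mul_comm b] at hk
      exact_mod_cast hk
    · have hkc : a * (k : ℝ) ^ 2 < b * c := by rw [sq]; exact_mod_cast hkc
      have : a / b * (k : ℝ) ^ 2 < c := by
        rwa [div_mul_eq_mul_div, div_lt_iff₀ hb', mul_comm (c : ℝ)]
      exact le_trans (by linarith) (le_abs_self _)

theorem IsMLRandom.tendsto_div (hu : IsMLRandom ν u) (hT : Primrec₂ T)
    (hℓ : Primrec ℓ) (hle : ∀ k, k ≤ ℓ k) (hST : ∀ v N, T (prefixList v (ℓ N)) N = S v N)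
    (hmono : Monotone (S u))
    (hmem : ∀ N, MemLp (fun v => (S v N : ℝ)) 2 ν) (hmean : ∀ N, ∫ v, (S v N : ℝ) ∂ν = ρ * N)
    (hC : 0 ≤ C) (hvar : ∀ N, ProbabilityTheory.variance (fun v => (S v N : ℝ)) ν ≤ C * N) :
    Tendsto (fun N : ℕ => (S u N : ℝ) / N) atTop (𝓝 ρ) := by
  refine tendsto_div_of_monotone_of_exists_subseq_tendsto_div _ ρ
    (fun _ _ h => Nat.cast_le.2 (hmono h)) fun a ha => ⟨fun k => k ^ 2, ?_,
      tendsto_pow_atTop two_ne_zero, hu.tendsto_sq_div_sq hT hℓ hle hST hmem hmean hC hvar⟩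
  have hratio : Tendsto (fun k : ℕ => (1 + 1 / (k : ℝ)) ^ 2) atTop (𝓝 1) := by
    simpa using (tendsto_one_div_atTop_nhds_zero_nat.const_add (1 : ℝ)).pow 2
  filter_upwards [hratio.eventually (eventually_le_nhds ha), eventually_gt_atTop 0] with k hk hk₀
  have : (0 : ℝ) < k := by exact_mod_cast hk₀
  push_cast
  calc ((k : ℝ) + 1) ^ 2 = (1 + 1 / (k : ℝ)) ^ 2 * k ^ 2 := by field_simp
    _ ≤ a * k ^ 2 := by gcongr

end LawOfLargeNumbers

section FiniteRangeDependence

variable {Ω : Type*} [MeasurableSpace Ω] {P : Measure Ω} {X : ℕ → Ω → ℝ} {B : ℝ} {s : ℕ}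

lemma card_filter_natAbs_sub_le (A : Finset ℕ) (s j : ℕ) :
    (A.filter fun k : ℕ => ((j : ℤ) - k).natAbs ≤ s).card ≤ 2 * s + 1 := by
  refine (Finset.card_le_card (t := Finset.Icc (j - s) (j + s)) fun k hk => ?_).trans ?_
  · rw [Finset.mem_filter] at hk
    rw [Finset.mem_Icc]
    omega
  · rw [Nat.card_Icc]
    omega

lemma variance_sum_range_le [IsFiniteMeasure P] (hX : ∀ j, MemLp (X j) 2 P)
    (hB : ∀ j k, ProbabilityTheory.covariance (X j) (X k) P ≤ B) (hB₀ : 0 ≤ B)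
    (hfar : ∀ j k : ℕ, s < ((j : ℤ) - k).natAbs →
      ProbabilityTheory.covariance (X j) (X k) P = 0) (N : ℕ) :
    ProbabilityTheory.variance (fun ω => ∑ j ∈ Finset.range N, X j ω) P ≤
      (2 * s + 1) * B * N := by
  rw [ProbabilityTheory.variance_fun_sum' fun j _ => hX j]
  calc ∑ j ∈ Finset.range N, ∑ k ∈ Finset.range N, ProbabilityTheory.covariance (X j) (X k) P
      ≤ ∑ j ∈ Finset.range N, ∑ k ∈ Finset.range N,
          if ((j : ℤ) - k).natAbs ≤ s then B else 0 := by
        refine Finset.sum_le_sum fun j _ => Finset.sum_le_sum fun k _ => ?_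
        split_ifs with hjk
        exacts [hB j k, (hfar j k (not_le.1 hjk)).le]
    _ ≤ ∑ _j ∈ Finset.range N, (2 * s + 1) * B := by
        refine Finset.sum_le_sum fun j _ => ?_
        rw [← Finset.sum_filter, Finset.sum_const, nsmul_eq_mul]
        refine mul_le_mul_of_nonneg_right ?_ hB₀
        exact_mod_cast card_filter_natAbs_sub_le _ s j
    _ = (2 * s + 1) * B * N := by
        rw [Finset.sum_const, Finset.card_range, nsmul_eq_mul, mul_comm]

end FiniteRangeDependence

section BlockCount

variable {F : (ℕ → Bool) → Bool} {e q : ℕ}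

/-- The number of `j < N` such that the sequence starting at position `q * j` of `u`
has property `F`. -/
def blockCount (F : (ℕ → Bool) → Bool) (q : ℕ) (u : ℕ → Bool) (N : ℕ) : ℕ :=
  ∑ j ∈ Finset.range N, (F fun d => u (q * j + d)).toNat

lemma exists_eq_comp_of_dependsOn_Iio (hF : DependsOn F (Set.Iio e)) :
    ∃ G : (Fin e → Bool) → Bool, ∀ u, F u = G fun d => u d := by
  refine ⟨fun v => F fun d => if hd : d < e then v ⟨d, hd⟩ else false, fun u => hF fun d hd => ?_⟩
  simp [Set.mem_Iio.1 hd]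

lemma primrec_blockCount (hF : DependsOn F (Set.Iio e)) (q : ℕ) :
    Primrec₂ fun (σ : List Bool) N => blockCount F q (fun i => σ.getD i false) N := by
  obtain ⟨G, hG⟩ := exists_eq_comp_of_dependsOn_Iio hF
  have hblock : Primrec₂ fun (σ : List Bool) (j : ℕ) =>
      (F fun d => σ.getD (q * j + d) false).toNat := by
    simp only [hG]
    refine (Primrec.dom_finite Bool.toNat).comp ((Primrec.dom_finite G).comp
      (Primrec.fin_curry.2 (Primrec.fin_curry₁.2 fun d => ?_).swap))
    exact (Primrec.list_getD false).comp Primrec.fst (Primrec.nat_add.comp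
      (Primrec.nat_mul.comp (Primrec.const q) Primrec.snd) (Primrec.const (d : ℕ)))
  have hrec : Primrec₂ fun (σ : List Bool) N =>
      (Nat.rec 0 (fun j c => c + (F fun d => σ.getD (q * j + d) false).toNat) N : ℕ) :=
    Primrec.nat_rec (Primrec.const 0) (Primrec.nat_add.comp (Primrec.snd.comp Primrec.snd)
      (hblock.comp Primrec.fst (Primrec.fst.comp Primrec.snd))).to₂
  refine hrec.of_eq fun σ N => ?_
  induction N with
  | zero => rfl
  | succ N ih => exact (congrArg (· + _) ih).trans (Finset.sum_range_succ _ N).symm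

lemma blockCount_prefixList (hF : DependsOn F (Set.Iio e)) (u : ℕ → Bool) (N : ℕ) :
    blockCount F q (fun i => (prefixList u (q * N + e)).getD i false) N =
      blockCount F q u N := by
  refine Finset.sum_congr rfl fun j hj => congrArg Bool.toNat (hF fun d hd => ?_)
  have hjN : q * j ≤ q * N := Nat.mul_le_mul_left q (Finset.mem_range.1 hj).le
  exact getD_prefixList u (add_lt_add_of_le_of_lt hjN hd)

lemma measurable_block (hF : DependsOn F (Set.Iio e)) (q j : ℕ) :
    Measurable fun u : ℕ → Bool => F fun d => u (q * j + d) := by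
  obtain ⟨G, hG⟩ := exists_eq_comp_of_dependsOn_Iio hF
  simp only [hG]
  exact Measurable.of_discrete.comp (measurable_pi_lambda _ fun d => measurable_pi_apply _)

lemma memLp_toNat_block (ν : Measure (ℕ → Bool)) [IsFiniteMeasure ν]
    (hF : DependsOn F (Set.Iio e)) (q j : ℕ) :
    MemLp (fun u => ((F fun d => u (q * j + d)).toNat : ℝ)) 2 ν :=
  MemLp.of_bound ((Measurable.of_discrete (f := fun b : Bool => (b.toNat : ℝ))).comp
    (measurable_block hF q j)).aestronglyMeasurable 1
    (ae_of_all _ fun _ => by simpa using Bool.toNat_le _)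

lemma covariance_toNat_block_le (ν : Measure (ℕ → Bool)) [IsProbabilityMeasure ν]
    (hF : DependsOn F (Set.Iio e)) (q j k : ℕ) :
    ProbabilityTheory.covariance (fun u => ((F fun d => u (q * j + d)).toNat : ℝ))
      (fun u => ((F fun d => u (q * k + d)).toNat : ℝ)) ν ≤ 1 := by
  rw [ProbabilityTheory.covariance_eq_sub (memLp_toNat_block ν hF q j)
    (memLp_toNat_block ν hF q k)]
  have hprod : ∫ u, ((F fun d => u (q * j + d)).toNat : ℝ) *
      (F fun d => u (q * k + d)).toNat ∂ν ≤ ∫ _u, (1 : ℝ) ∂ν := by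
    refine integral_mono ((memLp_toNat_block ν hF q j).integrable_mul
      (memLp_toNat_block ν hF q k)) (integrable_const 1) fun u => ?_
    exact_mod_cast mul_le_one' (Bool.toNat_le _) (Bool.toNat_le _)
  have hmean (j : ℕ) : 0 ≤ ∫ u, ((F fun d => u (q * j + d)).toNat : ℝ) ∂ν :=
    integral_nonneg fun _ => Nat.cast_nonneg _
  simp only [integral_const, probReal_univ, smul_eq_mul, mul_one] at hprod
  exact (sub_le_self _ (mul_nonneg (hmean j) (hmean k))).trans hprod

theorem IsMLRandom.tendsto_blockCount_div {ν : Measure (ℕ → Bool)} [IsProbabilityMeasure ν]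
    {u : ℕ → Bool} {s : ℕ} {ρ : ℝ} (hu : IsMLRandom ν u) (hF : DependsOn F (Set.Iio e))
    (hq : 0 < q) (hmean : ∀ j, ∫ v, ((F fun d => v (q * j + d)).toNat : ℝ) ∂ν = ρ)
    (hfar : ∀ j k : ℕ, s < ((j : ℤ) - k).natAbs →
      ProbabilityTheory.covariance (fun v => ((F fun d => v (q * j + d)).toNat : ℝ))
        (fun v => ((F fun d => v (q * k + d)).toNat : ℝ)) ν = 0) :
    Tendsto (fun N : ℕ => (blockCount F q u N : ℝ) / N) atTop (𝓝 ρ) := by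
  have hcast (v : ℕ → Bool) (N : ℕ) : (blockCount F q v N : ℝ) =
      ∑ j ∈ Finset.range N, ((F fun d => v (q * j + d)).toNat : ℝ) := by simp [blockCount]
  have hmem (j : ℕ) := memLp_toNat_block ν hF q j
  refine hu.tendsto_div (S := blockCount F q) (ℓ := fun N => q * N + e) (C := 2 * s + 1)
    (primrec_blockCount hF q)
    (Primrec.nat_add.comp (Primrec.nat_mul.comp (Primrec.const q) Primrec.id) (Primrec.const e))
    (fun N => (Nat.le_mul_of_pos_left N hq).trans (Nat.le_add_right _ _))
    (fun v N => blockCount_prefixList hF v N)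
    (fun _ _ hNM => Finset.sum_le_sum_of_subset (Finset.range_mono hNM))
    (fun N => ?_) (fun N => ?_) (by positivity) fun N => ?_
  · simpa only [hcast] using memLp_finsetSum _ fun j _ => hmem j
  · simp only [hcast]
    rw [integral_finsetSum _ fun j _ => (hmem j).integrable one_le_two]
    simp [hmean, mul_comm]
  · simpa only [hcast, mul_one] using variance_sum_range_le hmem
      (covariance_toNat_block_le ν hF q) zero_le_one hfar N

end BlockCount

/-! ### Averages over the lattice -/

lemma tendsto_average_shift_iff {g : ℕ → ℝ} {θ : ℝ} (k : ℕ) :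
    Tendsto (fun N : ℕ => (∑ j ∈ Finset.range N, g (j + k)) / N) atTop (𝓝 θ) ↔
      Tendsto (fun N : ℕ => (∑ j ∈ Finset.range N, g j) / N) atTop (𝓝 θ) := by
  have hadd : Tendsto (fun N : ℕ => (∑ j ∈ Finset.range k, g j) / (N : ℝ)) atTop (𝓝 0) :=
    tendsto_const_div_atTop_nhds_zero_nat _
  have hratio : Tendsto (fun N : ℕ => 1 + (k : ℝ) / N) atTop (𝓝 1) := by
    simpa using (tendsto_const_div_atTop_nhds_zero_nat (k : ℝ)).const_add 1
  have hsum (N : ℕ) : ∑ j ∈ Finset.range (N + k), g j =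
      ∑ j ∈ Finset.range N, g (j + k) + ∑ j ∈ Finset.range k, g j := by
    rw [add_comm N, Finset.sum_range_add, add_comm]
    simp only [add_comm k]
  rw [← tendsto_add_atTop_iff_nat (f := fun N : ℕ => (∑ j ∈ Finset.range N, g j) / (N : ℝ)) k]
  constructor <;> intro h
  · refine (((h.add hadd).div hratio one_ne_zero).congr' ?_).trans (by simp)
    filter_upwards [eventually_gt_atTop 0] with N hN
    rw [hsum, Pi.div_apply]
    push_cast
    field_simp
  · refine (((h.mul hratio).sub hadd).congr' ?_).trans (by simp)
    filter_upwards [eventually_gt_atTop 0] with N hN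
    rw [hsum]
    push_cast
    field_simp
    ring

lemma tendsto_average_translate {f : ℤ → ℝ} {θ : ℝ} {a : ℤ} (b : ℤ)
    (h : Tendsto (fun N : ℕ => (∑ j ∈ Finset.range N, f (j + a)) / N) atTop (𝓝 θ)) :
    Tendsto (fun N : ℕ => (∑ j ∈ Finset.range N, f (j + b)) / N) atTop (𝓝 θ) := by
  have hshift (a : ℤ) (k : ℕ) := tendsto_average_shift_iff (g := fun j => f (j + a)) (θ := θ) k
  simp only [Nat.cast_add, add_assoc] at hshift
  rcases le_total a b with hab | hab
  · obtain ⟨k, rfl⟩ := Int.le.dest hab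
    rw [add_comm a]
    exact (hshift a k).2 h
  · obtain ⟨k, rfl⟩ := Int.le.dest hab
    rw [add_comm b] at h
    exact (hshift b k).1 h

lemma tendsto_half_div : Tendsto (fun n : ℕ => ((n / 2 : ℕ) : ℝ) / n) atTop (𝓝 (1 / 2)) := by
  refine ((tendsto_nat_floor_mul_div_atTop (R := ℝ) (by norm_num : (0 : ℝ) ≤ 1 / 2)).comp
    tendsto_natCast_atTop_atTop).congr fun n => ?_
  have hfloor : ⌊(1 / 2 : ℝ) * n⌋₊ = n / 2 := by
    rw [one_div_mul_eq_div]
    exact_mod_cast Nat.floor_div_eq_div (K := ℝ) n 2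
  rw [Function.comp_apply, hfloor]

/-- The interval formed by the first `n` sites in the enumeration `site` of the lattice. -/
noncomputable def box (n : ℕ) : Finset ℤ := Finset.Ico (-((n / 2 : ℕ) : ℤ)) ((n + 1) / 2 : ℕ)

lemma site_two_mul (j : ℕ) : site (2 * j) = j := by
  simp [site]

lemma site_two_mul_add_one (j : ℕ) : site (2 * j + 1) = -((j : ℤ) + 1) := by
  rw [site, if_neg (by simp), show (2 * j + 1 + 1) / 2 = j + 1 by omega]
  push_cast
  rfl

lemma site_notMem_box (n : ℕ) : site n ∉ box n := by
  rw [box, Finset.mem_Ico]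
  rcases n.even_or_odd' with ⟨k, rfl | rfl⟩
  · rw [site_two_mul]
    omega
  · rw [site_two_mul_add_one]
    omega

lemma box_succ (n : ℕ) : box (n + 1) = insert (site n) (box n) := by
  ext i
  rw [box, box, Finset.mem_insert, Finset.mem_Ico, Finset.mem_Ico]
  rcases n.even_or_odd' with ⟨k, rfl | rfl⟩
  · rw [site_two_mul]
    omega
  · rw [site_two_mul_add_one]
    omega

lemma mem_box_iff {n : ℕ} {i : ℤ} : i ∈ box n ↔ ∃ k < n, site k = i := by
  induction n with
  | zero => simp [box]
  | succ n ih =>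
    rw [box_succ, Finset.mem_insert, ih, Nat.exists_lt_succ_right, or_comm, eq_comm]

lemma sum_box (f : ℤ → ℝ) (n : ℕ) : ∑ i ∈ box n, f i =
    ∑ j ∈ Finset.range (n - n / 2), f j + ∑ j ∈ Finset.range (n / 2), f (-j - 1) := by
  induction n with
  | zero => simp [box]
  | succ n ih =>
    rw [box_succ, Finset.sum_insert (site_notMem_box n), ih]
    rcases n.even_or_odd' with ⟨k, rfl | rfl⟩
    · rw [site_two_mul, show 2 * k + 1 - (2 * k + 1) / 2 = k + 1 by omega,
        show 2 * k - 2 * k / 2 = k by omega, show (2 * k + 1) / 2 = 2 * k / 2 by omega,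
        Finset.sum_range_succ]
      ring
    · rw [site_two_mul_add_one, show 2 * k + 1 + 1 - (2 * k + 1 + 1) / 2 = k + 1 by omega,
        show 2 * k + 1 - (2 * k + 1) / 2 = k + 1 by omega,
        show (2 * k + 1 + 1) / 2 = k + 1 by omega, show (2 * k + 1) / 2 = k by omega,
        Finset.sum_range_succ (fun j : ℕ => f (-j - 1)), neg_add']
      ring

lemma tendsto_average_comp_div {g : ℕ → ℝ} {θ c : ℝ} {h : ℕ → ℕ} (hh : Tendsto h atTop atTop)
    (hc : Tendsto (fun n : ℕ => (h n : ℝ) / n) atTop (𝓝 c))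
    (hg : Tendsto (fun N : ℕ => (∑ j ∈ Finset.range N, g j) / N) atTop (𝓝 θ)) :
    Tendsto (fun n : ℕ => (∑ j ∈ Finset.range (h n), g j) / n) atTop (𝓝 (θ * c)) := by
  refine ((hg.comp hh).mul hc).congr' ?_
  filter_upwards [hh.eventually_gt_atTop 0] with n hn
  rw [Function.comp_apply, div_mul_div_cancel₀]
  exact_mod_cast hn.ne'

lemma tendsto_average_box {f : ℤ → ℝ} {θ : ℝ} {a b : ℤ}
    (hright : Tendsto (fun N : ℕ => (∑ j ∈ Finset.range N, f (j + a)) / N) atTop (𝓝 θ))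
    (hleft : Tendsto (fun N : ℕ => (∑ j ∈ Finset.range N, f (-(j + b))) / N) atTop (𝓝 θ))
    (c : ℤ) : Tendsto (fun n : ℕ => (∑ i ∈ box n, f (i + c)) / n) atTop (𝓝 θ) := by
  have hhalf : Tendsto (fun n : ℕ => n / 2) atTop atTop := Nat.tendsto_div_const_atTop two_ne_zero
  have hhalf' : Tendsto (fun n : ℕ => n - n / 2) atTop atTop :=
    tendsto_atTop_mono (fun n => by omega) hhalf
  have hdiv : Tendsto (fun n : ℕ => ((n - n / 2 : ℕ) : ℝ) / n) atTop (𝓝 (1 / 2)) := by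
    have := tendsto_half_div.const_sub 1
    norm_num only at this
    refine this.congr' ?_
    filter_upwards [eventually_gt_atTop 0] with n hn
    rw [Nat.cast_sub (Nat.div_le_self n 2), sub_div, div_self (by positivity)]
  have hsum := (tendsto_average_comp_div hhalf' hdiv (tendsto_average_translate c hright)).add
    (tendsto_average_comp_div hhalf tendsto_half_div
      (tendsto_average_translate (f := fun i => f (-i)) (1 - c) hleft))
  rw [show θ * (1 / 2) + θ * (1 / 2) = θ by ring] at hsum
  refine hsum.congr fun n => ?_
  rw [sum_box, add_div]
  congr 3 with j
  congr 1
  ring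

/-! ### The dynamics -/

/-- The parity of the number of scatterers of `y` met in its last `t` steps by a particle which
is now at `i`. -/
def scattering (y : Config) : ℕ → ℤ → Bool
  | 0, _ => false
  | t + 1, i => xor (scattering y t (i - 1)) (y (i - 1))

lemma phi_iterate (t : ℕ) (z : Microstate) :
    phi^[t] z = (fun i => xor (z.1 (i - t)) (scattering z.2 t i), z.2) := by
  induction t with
  | zero => simp [scattering]
  | succ t ih =>
    rw [Function.iterate_succ_apply', ih, phi]
    simp only [scattering, Bool.xor_assoc, Nat.cast_succ, sub_sub, add_comm]

lemma phi_iterate_fst (t : ℕ) (z : Microstate) (i : ℤ) :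
    (phi^[t] z).1 i = xor (z.1 (i - t)) (scattering z.2 t i) := by
  rw [phi_iterate]

lemma phi_iterate_snd (t : ℕ) (z : Microstate) : (phi^[t] z).2 = z.2 := by
  rw [phi_iterate]

lemma sgn_scattering (y : Config) (t : ℕ) (i : ℤ) :
    sgn (scattering y t i) = ∏ a ∈ Finset.Ico (i - t) i, sgn (y a) := by
  induction t generalizing i with
  | zero => simp [scattering, sgn]
  | succ t ih =>
    have hIco : Finset.Ico (i - (t + 1 : ℕ)) i =
        insert (i - 1) (Finset.Ico (i - 1 - t) (i - 1)) := by
      ext a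
      simp only [Finset.mem_Ico, Finset.mem_insert]
      omega
    rw [scattering, sgn_xor, ih, hIco, Finset.prod_insert (by simp), mul_comm]

lemma scattering_congr {y y' : Config} {t : ℕ} {i : ℤ}
    (h : ∀ a ∈ Finset.Ico (i - t) i, y a = y' a) : scattering y t i = scattering y' t i := by
  induction t generalizing i with
  | zero => rfl
  | succ t ih =>
    simp only [Finset.mem_Ico] at h ih
    rw [scattering, scattering, ih fun a ha => h a (by omega), h (i - 1) (by omega)]

lemma phi_iterate_fst_congr {z w : Microstate} {t : ℕ} {i : ℤ} (hx : z.1 (i - t) = w.1 (i - t))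
    (hy : ∀ a ∈ Finset.Ico (i - t) i, z.2 a = w.2 a) : (phi^[t] z).1 i = (phi^[t] w).1 i := by
  rw [phi_iterate_fst, phi_iterate_fst, hx, scattering_congr hy]

/-- The microstate seen from the site `k`. -/
def translate (k : ℤ) (z : Microstate) : Microstate := (fun i => z.1 (i + k), fun i => z.2 (i + k))

lemma phi_iterate_translate (t : ℕ) (k : ℤ) (z : Microstate) :
    phi^[t] (translate k z) = translate k (phi^[t] z) := by
  have hcomm : Function.Commute phi (translate k) := fun z => by
    simp only [phi, translate, sub_add_eq_add_sub]
  exact hcomm.iterate_left t z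

lemma phi_reversal_phi (z : Microstate) : phi (reversal (phi z)) = reversal z := by
  refine Prod.ext (funext fun i => ?_) rfl
  have hi : -(i - 1) - 1 = -i := by ring
  simp only [phi, reversal, hi, Bool.xor_assoc, Bool.xor_self, Bool.xor_false]

lemma phi_iterate_reversal_phi_iterate (t : ℕ) (z : Microstate) :
    phi^[t] (reversal (phi^[t] z)) = reversal z := by
  induction t generalizing z with
  | zero => rfl
  | succ t ih => rw [Function.iterate_succ_apply phi t z, Function.iterate_succ_apply', ih,
      phi_reversal_phi]

lemma measurable_spin (i : ℤ) : Measurable fun z : Microstate => z.1 i :=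
  (measurable_pi_apply i).comp measurable_fst

lemma measurable_scatterer (i : ℤ) : Measurable fun z : Microstate => z.2 i :=
  (measurable_pi_apply i).comp measurable_snd

lemma measurable_sgn : Measurable sgn := Measurable.of_discrete

lemma measurable_xor : Measurable fun p : Bool × Bool => xor p.1 p.2 := Measurable.of_discrete

lemma measurable_phi : Measurable phi := by
  refine Measurable.prodMk (measurable_pi_lambda _ fun i => ?_) measurable_snd
  exact measurable_xor.comp ((measurable_spin (i - 1)).prodMk (measurable_scatterer (i - 1)))

/-! ### Correlations of the spins under the Gibbs measure -/

lemma sgn_phi_iterate_fst (s : ℕ) (z : Microstate) (i : ℤ) : sgn ((phi^[s] z).1 i) =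
    sgn (z.1 (i - s)) * ∏ a ∈ Finset.Ico (i - s) i, sgn (z.2 a) := by
  rw [phi_iterate_fst, sgn_xor, sgn_scattering]

section Spin

variable {m : ℝ × ℝ}

lemma integral_prod_sgn_mul_prod_sgn (hm₀ : m.1 ∈ Set.Icc (-1 : ℝ) 1)
    (hm₁ : m.2 ∈ Set.Icc (0 : ℝ) 1) (A B : Finset ℤ) :
    ∫ z, (∏ a ∈ A, sgn (z.1 a)) * ∏ a ∈ B, sgn (z.2 a) ∂gibbs m =
      (-m.1) ^ A.card * (1 - 2 * m.2) ^ B.card := by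
  rw [gibbs, integral_prod_mul (fun x : Config => ∏ a ∈ A, sgn (x a))
    (fun y : Config => ∏ a ∈ B, sgn (y a)), integral_prod_sgn (half_one_add_mem_Icc hm₀),
    integral_prod_sgn hm₁]
  ring

lemma integral_sgn_phi_iterate (hm₀ : m.1 ∈ Set.Icc (-1 : ℝ) 1) (hm₁ : m.2 ∈ Set.Icc (0 : ℝ) 1)
    (s : ℕ) (i : ℤ) :
    ∫ z, sgn ((phi^[s] z).1 i) ∂gibbs m = -m.1 * (1 - 2 * m.2) ^ s := by
  simpa [sgn_phi_iterate_fst] using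
    integral_prod_sgn_mul_prod_sgn hm₀ hm₁ {i - (s : ℤ)} (Finset.Ico (i - s) i)

lemma integral_sgn_phi_iterate_mul (hm₀ : m.1 ∈ Set.Icc (-1 : ℝ) 1)
    (hm₁ : m.2 ∈ Set.Icc (0 : ℝ) 1) {s : ℕ} {i k : ℤ} (hik : s < (i - k).natAbs) :
    ∫ z, sgn ((phi^[s] z).1 i) * sgn ((phi^[s] z).1 k) ∂gibbs m =
      (-m.1 * (1 - 2 * m.2) ^ s) * (-m.1 * (1 - 2 * m.2) ^ s) := by
  have hne : i - s ≠ k - s := by omega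
  have hdisj : Disjoint (Finset.Ico (i - s) i) (Finset.Ico (k - s) k) := by
    rw [Finset.disjoint_left]
    intro a hi hk
    rw [Finset.mem_Ico] at hi hk
    omega
  have h := integral_prod_sgn_mul_prod_sgn hm₀ hm₁ {i - (s : ℤ), k - s}
    (Finset.Ico (i - s) i ∪ Finset.Ico (k - s) k)
  simp only [Finset.prod_pair hne, Finset.prod_union hdisj, Finset.card_pair hne,
    Finset.card_union_of_disjoint hdisj, Int.card_Ico, sub_sub_cancel, Int.toNat_natCast] at h
  simp only [sgn_phi_iterate_fst, mul_mul_mul_comm (sgn _) (∏ _ ∈ _, _), h]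
  ring

lemma memLp_sgn_phi_iterate (P : Measure Microstate) [IsFiniteMeasure P] (s : ℕ) (i : ℤ) :
    MemLp (fun z => sgn ((phi^[s] z).1 i)) 2 P :=
  MemLp.of_bound
    (measurable_sgn.comp ((measurable_spin i).comp (measurable_phi.iterate s))).aestronglyMeasurable
    1 (ae_of_all _ fun _ => (abs_sgn _).le)

lemma covariance_sgn_phi_iterate (hm₀ : m.1 ∈ Set.Icc (-1 : ℝ) 1)
    (hm₁ : m.2 ∈ Set.Icc (0 : ℝ) 1) {s : ℕ} {i k : ℤ} (hik : s < (i - k).natAbs) :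
    ProbabilityTheory.covariance (fun z => sgn ((phi^[s] z).1 i))
      (fun z => sgn ((phi^[s] z).1 k)) (gibbs m) = 0 := by
  rw [ProbabilityTheory.covariance_eq_sub (memLp_sgn_phi_iterate _ s i)
    (memLp_sgn_phi_iterate _ s k)]
  simp only [Pi.mul_apply, integral_sgn_phi_iterate hm₀ hm₁,
    integral_sgn_phi_iterate_mul hm₀ hm₁ hik, sub_self]

end Spin

/-! ### Spin averages of random microstates -/

lemma code_two_mul (z : Microstate) (k : ℕ) : code z (2 * k) = z.1 (site k) := by
  simp [code, kappa, iota]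

lemma code_two_mul_add_one (z : Microstate) (k : ℕ) : code z (2 * k + 1) = z.2 (site k) := by
  have hdiv : (2 * k + 1) / 2 = k := by omega
  simp [code, kappa, iota, hdiv]

lemma measurable_code : Measurable code := by
  refine measurable_pi_lambda _ fun n => ?_
  obtain ⟨k, rfl | rfl⟩ := n.even_or_odd'
  · simpa only [code_two_mul] using measurable_spin (site k)
  · simpa only [code_two_mul_add_one] using measurable_scatterer (site k)

lemma toNat_eq_half_one_sub_sgn (b : Bool) : (b.toNat : ℝ) = (1 - sgn b) / 2 := by
  cases b <;> norm_num [sgn]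

section SpinAverage

variable {m : ℝ × ℝ} {z : Microstate}

/-- The decoder of the sites to the right: it reads the spins and scatterers of the sites
`j, j + 1, …` off the bits of the code from position `4 j` on, shifted by `j` to the sites
`0, 1, …`. -/
def rightHalf (u : ℕ → Bool) : Microstate :=
  (fun i => u (4 * i.toNat), fun i => u (4 * i.toNat + 1))

/-- The decoder of the sites to the left: it reads the spins and scatterers of the sites
`-1 - j, -2 - j, …` off the bits of the code from position `4 j` on, shifted by `j` to the sites
`-1, -2, …`. -/
def leftHalf (u : ℕ → Bool) : Microstate :=
  (fun i => u (4 * (-i - 1).toNat + 2), fun i => u (4 * (-i - 1).toNat + 3))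

lemma phi_iterate_rightHalf (s : ℕ) (w : Microstate) (j : ℕ) :
    (phi^[s] (rightHalf fun d => code w (4 * j + d))).1 s = (phi^[s] w).1 (j + s) := by
  have hspin (k : ℕ) : code w (4 * j + 4 * k) = w.1 (k + j) := by
    rw [show 4 * j + 4 * k = 2 * (2 * (k + j)) by ring, code_two_mul, site_two_mul, Nat.cast_add]
  have hscatterer (k : ℕ) : code w (4 * j + (4 * k + 1)) = w.2 (k + j) := by
    rw [show 4 * j + (4 * k + 1) = 2 * (2 * (k + j)) + 1 by ring, code_two_mul_add_one,
      site_two_mul, Nat.cast_add]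
  calc _ = (phi^[s] (translate j w)).1 s := phi_iterate_fst_congr
        (by simp [rightHalf, translate, hspin]) fun a ha => by
          rw [Finset.mem_Ico] at ha
          simp only [rightHalf, translate, hscatterer, Int.toNat_of_nonneg (show 0 ≤ a by omega)]
    _ = (phi^[s] w).1 (s + j) := by rw [phi_iterate_translate, translate]
    _ = _ := by rw [add_comm]

lemma phi_iterate_leftHalf (s : ℕ) (w : Microstate) (j : ℕ) :
    (phi^[s] (leftHalf fun d => code w (4 * j + d))).1 (-1) = (phi^[s] w).1 (-(j + 1)) := by
  have hsite (k : ℕ) : site (2 * (k + j) + 1) = -(k + 1) + -j := by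
    rw [site_two_mul_add_one]; push_cast; ring
  have hspin (k : ℕ) : code w (4 * j + (4 * k + 2)) = w.1 (-(k + 1) + -j) := by
    rw [show 4 * j + (4 * k + 2) = 2 * (2 * (k + j) + 1) by ring, code_two_mul, hsite]
  have hscatterer (k : ℕ) : code w (4 * j + (4 * k + 3)) = w.2 (-(k + 1) + -j) := by
    rw [show 4 * j + (4 * k + 3) = 2 * (2 * (k + j) + 1) + 1 by ring, code_two_mul_add_one, hsite]
  have hcast {a : ℤ} (ha : a ≤ -1) : -(((-a - 1).toNat : ℤ) + 1) = a := by omega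
  calc _ = (phi^[s] (translate (-j) w)).1 (-1) := phi_iterate_fst_congr
        (by simp only [leftHalf, translate, hspin, hcast (show -1 - (s : ℤ) ≤ -1 by omega)])
        fun a ha => by
          rw [Finset.mem_Ico] at ha
          simp only [leftHalf, translate, hscatterer, hcast (show a ≤ -1 by omega)]
    _ = (phi^[s] w).1 (-1 + -j) := by rw [phi_iterate_translate, translate]
    _ = _ := by rw [neg_add, add_comm]

lemma dependsOn_phi_iterate_rightHalf (s : ℕ) :
    DependsOn (fun u => (phi^[s] (rightHalf u)).1 s) (Set.Iio (4 * s + 4)) := fun u v huv =>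
  phi_iterate_fst_congr (huv _ (by simp)) fun a ha => huv _ (by
    rw [Finset.mem_Ico] at ha
    simp only [Set.mem_Iio]
    omega)

lemma dependsOn_phi_iterate_leftHalf (s : ℕ) :
    DependsOn (fun u => (phi^[s] (leftHalf u)).1 (-1)) (Set.Iio (4 * s + 4)) := fun u v huv =>
  phi_iterate_fst_congr (huv _ (by simp)) fun a ha => huv _ (by
    rw [Finset.mem_Ico] at ha
    simp only [Set.mem_Iio]
    omega)

lemma tendsto_average_sgn_of_decoder {F : (ℕ → Bool) → Bool} {e s : ℕ} {c : ℕ → ℤ}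
    (hm₀ : m.1 ∈ Set.Icc (-1 : ℝ) 1) (hm₁ : m.2 ∈ Set.Icc (0 : ℝ) 1)
    (hz : IsMLRandomState (gibbs m) z) (hF : DependsOn F (Set.Iio e))
    (hcode : ∀ w j, F (fun d => code w (4 * j + d)) = (phi^[s] w).1 (c j))
    (hc : ∀ j k : ℕ, (c j - c k).natAbs = ((j : ℤ) - k).natAbs) :
    Tendsto (fun N : ℕ => (∑ j ∈ Finset.range N, sgn ((phi^[s] z).1 (c j))) / N) atTop
      (𝓝 (-m.1 * (1 - 2 * m.2) ^ s)) := by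
  set θ := -m.1 * (1 - 2 * m.2) ^ s with hθ
  have : IsProbabilityMeasure ((gibbs m).map code) :=
    Measure.isProbabilityMeasure_map measurable_code.aemeasurable
  have hmem (j : ℕ) := memLp_toNat_block ((gibbs m).map code) hF 4 j
  have hsgn (j : ℕ) := memLp_sgn_phi_iterate (gibbs m) s (c j)
  have hcount : Tendsto (fun N : ℕ => (blockCount F 4 (code z) N : ℝ) / N) atTop
      (𝓝 ((1 - θ) / 2)) := by
    refine IsMLRandom.tendsto_blockCount_div (s := s) hz hF four_pos (fun j => ?_)
      fun j k hjk => ?_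
    · rw [integral_map measurable_code.aemeasurable (hmem j).aestronglyMeasurable]
      simp only [hcode, toNat_eq_half_one_sub_sgn]
      rw [integral_div, integral_sub (integrable_const _) ((hsgn j).integrable one_le_two),
        integral_sgn_phi_iterate hm₀ hm₁]
      simp [hθ]
    · rw [ProbabilityTheory.covariance_map_fun (hmem j).aestronglyMeasurable
        (hmem k).aestronglyMeasurable measurable_code.aemeasurable]
      simp only [hcode, toNat_eq_half_one_sub_sgn]
      rw [ProbabilityTheory.covariance_fun_div_left, ProbabilityTheory.covariance_fun_div_right,
        ProbabilityTheory.covariance_const_sub_left ((hsgn j).integrable one_le_two),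
        ProbabilityTheory.covariance_const_sub_right ((hsgn k).integrable one_le_two),
        covariance_sgn_phi_iterate hm₀ hm₁ (by rwa [hc])]
      simp
  refine ((hcount.const_mul 2).const_sub 1).congr' ?_ |>.trans_eq (by ring_nf)
  filter_upwards [eventually_ne_atTop 0] with N hN
  have : (N : ℝ) ≠ 0 := Nat.cast_ne_zero.2 hN
  simp only [blockCount, hcode, Nat.cast_sum, toNat_eq_half_one_sub_sgn, ← Finset.sum_div,
    Finset.sum_sub_distrib, Finset.sum_const, Finset.card_range, nsmul_eq_mul, mul_one]
  field_simp
  ring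

theorem IsMLRandomState.tendsto_average_sgn (hm₀ : m.1 ∈ Set.Icc (-1 : ℝ) 1)
    (hm₁ : m.2 ∈ Set.Icc (0 : ℝ) 1) (hz : IsMLRandomState (gibbs m) z) (s : ℕ) (c : ℤ) :
    Tendsto (fun n : ℕ => (∑ i ∈ box n, sgn ((phi^[s] z).1 (i + c))) / n) atTop
      (𝓝 (-m.1 * (1 - 2 * m.2) ^ s)) :=
  tendsto_average_box (f := fun i => sgn ((phi^[s] z).1 i))
    (tendsto_average_sgn_of_decoder hm₀ hm₁ hz (dependsOn_phi_iterate_rightHalf s)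
      (c := fun j => j + s) (phi_iterate_rightHalf s) fun j k => by omega)
    (tendsto_average_sgn_of_decoder hm₀ hm₁ hz (dependsOn_phi_iterate_leftHalf s)
      (c := fun j => -(j + 1)) (phi_iterate_leftHalf s) fun j k => by omega) c

end SpinAverage

/-! ### The bits of a random microstate have positive probability -/

section Positivity

variable {m : ℝ × ℝ} {z : Microstate}

lemma IsMLRandom.measure_setOf_apply_eq_ne_zero {ν : Measure (ℕ → Bool)} {u : ℕ → Bool}
    (hu : IsMLRandom ν u) (k : ℕ) : ν {v | v k = u k} ≠ 0 := fun hnull =>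
  hu.measure_cylinder_ne_zero (k + 1) <| measure_mono_null (fun v hv => by
    simpa [prefixList] using hv k (by simp)) hnull

lemma exists_site_eq (i : ℤ) : ∃ k, site k = i := by
  obtain ⟨k, -, hk⟩ := mem_box_iff.1 (show i ∈ box (2 * i.natAbs + 2) by
    rw [box, Finset.mem_Ico]; omega)
  exact ⟨k, hk⟩

lemma bernoulliConfig_setOf_apply_eq {p : ℝ} (hp : p ∈ Set.Icc (0 : ℝ) 1) (i : ℤ) (b : Bool) :
    bernoulliConfig p {x | x i = b} = ENNReal.ofReal (weight p b) := by
  simpa using bernoulliConfig_setOf_eqOn hp {i} fun _ => b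

lemma measurableSet_setOf_apply_eq {ι : Type*} (i : ι) (b : Bool) :
    MeasurableSet {x : ι → Bool | x i = b} :=
  measurableSet_eq_fun (measurable_pi_apply i) measurable_const

lemma IsMLRandomState.weight_spin_ne_zero (hm₀ : m.1 ∈ Set.Icc (-1 : ℝ) 1)
    (hz : IsMLRandomState (gibbs m) z) (i : ℤ) : weight ((1 + m.1) / 2) (z.1 i) ≠ 0 := by
  obtain ⟨k, rfl⟩ := exists_site_eq i
  have hpos := IsMLRandom.measure_setOf_apply_eq_ne_zero hz (2 * k)
  rw [Measure.map_apply measurable_code (measurableSet_setOf_apply_eq _ _)] at hpos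
  simp only [Set.preimage_ofPred_eq, code_two_mul] at hpos
  intro hw
  refine hpos ((measurePreserving_fst.measure_preimage
    (measurableSet_setOf_apply_eq _ _).nullMeasurableSet).trans ?_)
  rw [bernoulliConfig_setOf_apply_eq (half_one_add_mem_Icc hm₀), hw, ENNReal.ofReal_zero]

lemma IsMLRandomState.weight_scatterer_ne_zero (hm₁ : m.2 ∈ Set.Icc (0 : ℝ) 1)
    (hz : IsMLRandomState (gibbs m) z) (i : ℤ) : weight m.2 (z.2 i) ≠ 0 := by
  obtain ⟨k, rfl⟩ := exists_site_eq i
  have hpos := IsMLRandom.measure_setOf_apply_eq_ne_zero hz (2 * k + 1)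
  rw [Measure.map_apply measurable_code (measurableSet_setOf_apply_eq _ _)] at hpos
  simp only [Set.preimage_ofPred_eq, code_two_mul_add_one] at hpos
  intro hw
  refine hpos ((measurePreserving_snd.measure_preimage
    (measurableSet_setOf_apply_eq _ _).nullMeasurableSet).trans ?_)
  rw [bernoulliConfig_setOf_apply_eq hm₁, hw, ENNReal.ofReal_zero]

end Positivity

/-! ### Probabilities of windows -/

/-- The microstates which agree with `z` in the spins at `A` and in the scatterers at `B`. -/
def pinned (A B : Finset ℤ) (z : Microstate) : Set Microstate :=
  {x | ∀ i ∈ A, x i = z.1 i} ×ˢ {y | ∀ i ∈ B, y i = z.2 i}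

lemma measurableSet_pinned (A B : Finset ℤ) (z : Microstate) : MeasurableSet (pinned A B z) :=
  (measurableSet_setOf_eqOn A z.1).prod (measurableSet_setOf_eqOn B z.2)

lemma window_eq_pinned (z : Microstate) (n : ℕ) : window z n = pinned (box n) (box n) z := by
  ext w
  simp only [window, pinned, iota, mem_box_iff, Set.mem_prod, Set.mem_ofPred_eq, forall_and,
    forall_exists_index, and_imp, forall_apply_eq_imp_iff₂]

lemma reversal_involutive : Function.Involutive reversal := fun z => by
  ext <;> simp [reversal]

lemma reversal_image_window (z : Microstate) (n : ℕ) : reversal '' window z n =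
    pinned ((box n).map (Equiv.neg ℤ).toEmbedding)
      ((box n).map ((Equiv.neg ℤ).trans (Equiv.subRight 1)).toEmbedding) (reversal z) := by
  rw [reversal_involutive.image_eq_preimage_symm, window_eq_pinned]
  ext w
  simp only [pinned, reversal, Set.mem_preimage, Set.mem_prod, Set.mem_ofPred_eq,
    Finset.forall_mem_map, Equiv.coe_toEmbedding, Equiv.trans_apply, Equiv.neg_apply,
    Equiv.subRight_apply, neg_neg, neg_sub, sub_neg_eq_add, add_sub_cancel_left]

section WindowProbability

variable {m : ℝ × ℝ} {A B : Finset ℤ} {t : ℕ} {z : Microstate}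

lemma map_phi_iterate_pinned (hm₀ : m.1 ∈ Set.Icc (-1 : ℝ) 1) (A B : Finset ℤ) (t : ℕ)
    (z : Microstate) : (gibbs m).map phi^[t] (pinned A B (phi^[t] z)) =
      ∫⁻ y in {y | ∀ i ∈ B, y i = z.2 i},
        ENNReal.ofReal (∏ i ∈ A, weight ((1 + m.1) / 2)
          (xor (z.1 (i - t)) (xor (scattering z.2 t i) (scattering y t i))))
        ∂bernoulliConfig m.2 := by
  rw [Measure.map_apply (measurable_phi.iterate t) (measurableSet_pinned _ _ _), gibbs,
    Measure.prod_apply_symm (measurable_phi.iterate t (measurableSet_pinned _ _ _)),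
    ← lintegral_indicator (measurableSet_setOf_eqOn B z.2)]
  have hxor : ∀ a b c d : Bool, xor a b = xor c d ↔ a = xor c (xor d b) := by decide
  refine lintegral_congr fun y => ?_
  by_cases hy : y ∈ {y : Config | ∀ i ∈ B, y i = z.2 i}
  · have hfiber : (fun x => (x, y)) ⁻¹' (phi^[t] ⁻¹' pinned A B (phi^[t] z)) =
        {x : Config | ∀ j ∈ A.map (Equiv.subRight (t : ℤ)).toEmbedding, x j =
          xor (z.1 j) (xor (scattering z.2 t (j + t)) (scattering y t (j + t)))} := by
      ext x
      simp only [Set.mem_preimage, pinned, phi_iterate, Set.mem_prod, Set.mem_ofPred_eq,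
        Finset.forall_mem_map, Equiv.coe_toEmbedding, Equiv.subRight_apply, sub_add_cancel, hxor]
      exact and_iff_left hy
    rw [Set.indicator_of_mem hy, hfiber, bernoulliConfig_setOf_eqOn (half_one_add_mem_Icc hm₀)
      (A.map _) fun j => xor (z.1 j) (xor (scattering z.2 t (j + t)) (scattering y t (j + t)))]
    simp
  · rw [Set.indicator_of_notMem hy]
    convert measure_empty (μ := bernoulliConfig ((1 + m.1) / 2))
    refine Set.eq_empty_of_forall_notMem fun x hx => hy ?_
    simpa [pinned, phi_iterate] using hx.2

lemma map_phi_iterate_pinned_eq_zero (hm₀ : m.1 ∈ Set.Icc (-1 : ℝ) 1) {i : ℤ} (hi : i ∈ A)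
    (hB : Finset.Ico (i - t) i ⊆ B) (hw : weight ((1 + m.1) / 2) (z.1 (i - t)) = 0) :
    (gibbs m).map phi^[t] (pinned A B (phi^[t] z)) = 0 := by
  rw [map_phi_iterate_pinned hm₀]
  refine setLIntegral_eq_zero (measurableSet_setOf_eqOn B z.2) fun y hy => ?_
  have hscattering : scattering y t i = scattering z.2 t i :=
    scattering_congr fun a ha => hy a (hB ha)
  rw [Finset.prod_eq_zero hi (by rw [hscattering, Bool.xor_self, Bool.xor_false, hw]),
    ENNReal.ofReal_zero, Pi.zero_apply]

lemma map_phi_iterate_pinned_of_ae_scattering_eq (hm₀ : m.1 ∈ Set.Icc (-1 : ℝ) 1)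
    (hm₁ : m.2 ∈ Set.Icc (0 : ℝ) 1)
    (hscattering : ∀ᵐ y ∂bernoulliConfig m.2, scattering y t = scattering z.2 t) :
    (gibbs m).map phi^[t] (pinned A B (phi^[t] z)) =
      ENNReal.ofReal (∏ i ∈ A, weight ((1 + m.1) / 2) (z.1 (i - t))) *
        ENNReal.ofReal (∏ i ∈ B, weight m.2 (z.2 i)) := by
  rw [map_phi_iterate_pinned hm₀, ← bernoulliConfig_setOf_eqOn hm₁, ← setLIntegral_const]
  refine lintegral_congr_ae ?_
  filter_upwards [ae_restrict_of_ae hscattering] with y hy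
  simp only [hy, Bool.xor_self, Bool.xor_false]

lemma weight_le_one {p : ℝ} (hp : p ∈ Set.Icc (0 : ℝ) 1) (b : Bool) : weight p b ≤ 1 := by
  obtain ⟨hp₀, hp₁⟩ := hp
  cases b <;> simp [weight, hp₀, hp₁]

lemma min_le_weight (p : ℝ) (b : Bool) : min p (1 - p) ≤ weight p b := by
  cases b <;> simp [weight]

lemma weight_pos {p : ℝ} (hp : p ∈ Set.Ioo (0 : ℝ) 1) (b : Bool) : 0 < weight p b :=
  (lt_min hp.1 (sub_pos.2 hp.2)).trans_le (min_le_weight p b)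

lemma min_pow_mul_prod_weight_le {p : ℝ} (hp : p ∈ Set.Icc (0 : ℝ) 1) {A : Finset ℤ}
    {x x' : Config} {k : ℕ} (hk : (A.filter fun i => x i ≠ x' i).card ≤ k) :
    min p (1 - p) ^ k * ∏ i ∈ A, weight p (x i) ≤ ∏ i ∈ A, weight p (x' i) := by
  have hr : 0 ≤ min p (1 - p) := le_min hp.1 (sub_nonneg.2 hp.2)
  have hr' : min p (1 - p) ≤ 1 := (min_le_left _ _).trans hp.2
  calc min p (1 - p) ^ k * ∏ i ∈ A, weight p (x i)
      ≤ (∏ i ∈ A, if x i ≠ x' i then min p (1 - p) else 1) * ∏ i ∈ A, weight p (x i) := by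
        rw [← Finset.prod_filter, Finset.prod_const]
        exact mul_le_mul_of_nonneg_right (pow_le_pow_of_le_one hr hr' hk)
          (Finset.prod_nonneg fun i _ => weight_nonneg hp _)
    _ = ∏ i ∈ A, (if x i ≠ x' i then min p (1 - p) else 1) * weight p (x i) :=
        Finset.prod_mul_distrib.symm
    _ ≤ ∏ i ∈ A, weight p (x' i) := by
        refine Finset.prod_le_prod (fun i _ => ?_) fun i _ => ?_
        · split_ifs <;> positivity [weight_nonneg hp (x i)]
        · split_ifs with hi
          · exact (mul_le_of_le_one_right hr (weight_le_one hp _)).trans (min_le_weight p _)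
          · rw [one_mul, not_not.1 hi]

lemma card_filter_xor_scattering_ne_le {x y y' : Config} {k : ℕ} (hy : ∀ i ∈ B, y i = y' i)
    (hAB : (A.filter fun i => ¬ Finset.Ico (i - (t : ℤ)) i ⊆ B).card ≤ k) :
    (A.filter fun i => xor (x (i - t)) (xor (scattering y' t i) (scattering y t i)) ≠
      x (i - t)).card ≤ k := by
  refine (Finset.card_le_card (Finset.monotone_filter_right A fun i _ hne hB => hne ?_)).trans hAB
  rw [scattering_congr fun a ha => hy a (hB ha), Bool.xor_self, Bool.xor_false]

lemma le_map_phi_iterate_pinned (hm₀ : m.1 ∈ Set.Icc (-1 : ℝ) 1) (hm₁ : m.2 ∈ Set.Icc (0 : ℝ) 1)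
    {k : ℕ} (hAB : (A.filter fun i => ¬ Finset.Ico (i - (t : ℤ)) i ⊆ B).card ≤ k) :
    min ((1 + m.1) / 2) (1 - (1 + m.1) / 2) ^ k *
        ((∏ i ∈ A, weight ((1 + m.1) / 2) (z.1 (i - t))) * ∏ i ∈ B, weight m.2 (z.2 i)) ≤
      ((gibbs m).map phi^[t]).real (pinned A B (phi^[t] z)) := by
  have hp := half_one_add_mem_Icc hm₀
  have hr : 0 ≤ min ((1 + m.1) / 2) (1 - (1 + m.1) / 2) := le_min hp.1 (sub_nonneg.2 hp.2)
  have hP : 0 ≤ ∏ i ∈ A, weight ((1 + m.1) / 2) (z.1 (i - t)) :=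
    Finset.prod_nonneg fun i _ => weight_nonneg hp _
  refine (ENNReal.ofReal_le_iff_le_toReal (measure_ne_top _ _)).1 ?_
  rw [map_phi_iterate_pinned hm₀, ← mul_assoc, ENNReal.ofReal_mul (by positivity),
    ← bernoulliConfig_setOf_eqOn hm₁, ← setLIntegral_const]
  refine setLIntegral_mono' (measurableSet_setOf_eqOn B z.2) fun y hy =>
    ENNReal.ofReal_le_ofReal ?_
  refine min_pow_mul_prod_weight_le hp ?_
  simpa only [ne_comm] using card_filter_xor_scattering_ne_le (x := z.1) hy hAB

lemma map_phi_iterate_pinned_le (hm₀ : m.1 ∈ Set.Icc (-1 : ℝ) 1) (hm₁ : m.2 ∈ Set.Icc (0 : ℝ) 1)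
    {k : ℕ} (hAB : (A.filter fun i => ¬ Finset.Ico (i - (t : ℤ)) i ⊆ B).card ≤ k) :
    min ((1 + m.1) / 2) (1 - (1 + m.1) / 2) ^ k *
        ((gibbs m).map phi^[t]).real (pinned A B (phi^[t] z)) ≤
      (∏ i ∈ A, weight ((1 + m.1) / 2) (z.1 (i - t))) * ∏ i ∈ B, weight m.2 (z.2 i) := by
  have hp := half_one_add_mem_Icc hm₀
  have hr : 0 ≤ min ((1 + m.1) / 2) (1 - (1 + m.1) / 2) := le_min hp.1 (sub_nonneg.2 hp.2)
  have hP : 0 ≤ ∏ i ∈ A, weight ((1 + m.1) / 2) (z.1 (i - t)) :=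
    Finset.prod_nonneg fun i _ => weight_nonneg hp _
  have hQ : 0 ≤ ∏ i ∈ B, weight m.2 (z.2 i) := Finset.prod_nonneg fun i _ => weight_nonneg hm₁ _
  rw [← ENNReal.ofReal_le_ofReal_iff (by positivity), ENNReal.ofReal_mul (by positivity),
    ENNReal.ofReal_mul hP, ofReal_measureReal, map_phi_iterate_pinned hm₀,
    ← lintegral_const_mul' _ _ ENNReal.ofReal_ne_top, ← bernoulliConfig_setOf_eqOn hm₁,
    ← setLIntegral_const]
  refine setLIntegral_mono' (measurableSet_setOf_eqOn B z.2) fun y hy => ?_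
  rw [← ENNReal.ofReal_mul (by positivity)]
  exact ENNReal.ofReal_le_ofReal
    (min_pow_mul_prod_weight_le hp (card_filter_xor_scattering_ne_le hy hAB))

end WindowProbability

/-! ### The rate of irreversible information loss -/

lemma phi_iterate_reversal_phi_iterate_two_mul (t : ℕ) (z : Microstate) :
    phi^[t] (reversal (phi^[2 * t] z)) = reversal (phi^[t] z) := by
  rw [two_mul, Function.iterate_add_apply, phi_iterate_reversal_phi_iterate]

lemma card_filter_not_Ico_sub_subset_le {A B : Finset ℤ} {a b : ℤ} (hA : A ⊆ Finset.Icc a b)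
    (hB : Finset.Ico a b ⊆ B) (t : ℕ) :
    (A.filter fun i => ¬ Finset.Ico (i - (t : ℤ)) i ⊆ B).card ≤ t := by
  calc _ ≤ (Finset.Ico a (a + t)).card := Finset.card_le_card fun i hi => by
        obtain ⟨hiA, hiB⟩ := Finset.mem_filter.1 hi
        obtain ⟨hai, hib⟩ := Finset.mem_Icc.1 (hA hiA)
        refine Finset.mem_Ico.2 ⟨hai, lt_of_not_ge fun hi' => hiB ?_⟩
        exact (Finset.Ico_subset_Ico (by omega) hib).trans hB
    _ = t := by simp

lemma abs_log_sub_log_le {a b c : ℝ} (hb : 0 < b) (hc : 0 < c) (hba : c * b ≤ a)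
    (hab : c * a ≤ b) : |Real.log a - Real.log b| ≤ -Real.log c := by
  have ha : 0 < a := (mul_pos hc hb).trans_le hba
  have hlog_le := Real.log_le_log (mul_pos hc ha) hab
  have hle_log := Real.log_le_log (mul_pos hc hb) hba
  rw [Real.log_mul hc.ne' ha.ne'] at hlog_le
  rw [Real.log_mul hc.ne' hb.ne'] at hle_log
  rw [abs_le]
  constructor <;> linarith

lemma tendsto_div_of_abs_sub_le {a b : ℕ → ℝ} {C L : ℝ} (hab : ∀ n, |a n - b n| ≤ C)
    (hb : Tendsto (fun n : ℕ => b n / n) atTop (𝓝 L)) :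
    Tendsto (fun n : ℕ => a n / n) atTop (𝓝 L) := by
  have herror : Tendsto (fun n : ℕ => (a n - b n) / n) atTop (𝓝 0) := by
    refine squeeze_zero_norm (fun n => ?_) (tendsto_const_div_atTop_nhds_zero_nat C)
    rw [norm_div, Real.norm_eq_abs, Real.norm_natCast]
    exact div_le_div_of_nonneg_right (hab n) n.cast_nonneg
  simpa only [add_zero, ← add_div, add_sub_cancel] using hb.add herror

section InfoLoss

variable {m : ℝ × ℝ} {z : Microstate} {t : ℕ}

lemma log_weight (p : ℝ) (b : Bool) :
    Real.log (weight p b) = (Real.log p + Real.log (1 - p)) / 2 +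
      (Real.log (1 - p) - Real.log p) / 2 * sgn b := by
  cases b <;> simp [weight, sgn] <;> ring

lemma IsMLRandomState.tendsto_average_log_weight (hm₀ : m.1 ∈ Set.Icc (-1 : ℝ) 1)
    (hm₁ : m.2 ∈ Set.Icc (0 : ℝ) 1) (hz : IsMLRandomState (gibbs m) z) (p : ℝ) (s : ℕ) (c : ℤ) :
    Tendsto (fun n : ℕ => (∑ i ∈ box n, Real.log (weight p ((phi^[s] z).1 (i + c)))) / n) atTop
      (𝓝 ((Real.log p + Real.log (1 - p)) / 2 +
        (Real.log (1 - p) - Real.log p) / 2 * (-m.1 * (1 - 2 * m.2) ^ s))) := by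
  refine (((hz.tendsto_average_sgn hm₀ hm₁ s c).const_mul _).const_add _).congr' ?_
  filter_upwards [eventually_ne_atTop 0] with n hn
  have : (n : ℝ) ≠ 0 := Nat.cast_ne_zero.2 hn
  have hcard : ((box n).card : ℝ) = n := by
    rw [box, Int.card_Ico]; norm_cast; omega
  simp only [log_weight, Finset.sum_add_distrib, Finset.sum_const, nsmul_eq_mul, hcard,
    ← Finset.mul_sum]
  field_simp

lemma abs_log_map_phi_iterate_pinned_sub_le (hm₀ : m.1 ∈ Set.Ioo (-1 : ℝ) 1)
    (hm₁ : m.2 ∈ Set.Icc (0 : ℝ) 1) {A B : Finset ℤ} {k : ℕ}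
    (hz : ∀ i ∈ B, weight m.2 (z.2 i) ≠ 0)
    (hAB : (A.filter fun i => ¬ Finset.Ico (i - (t : ℤ)) i ⊆ B).card ≤ k) :
    0 < ((gibbs m).map phi^[t]).real (pinned A B (phi^[t] z)) ∧
      |Real.log (((gibbs m).map phi^[t]).real (pinned A B (phi^[t] z))) -
        (∑ i ∈ A, Real.log (weight ((1 + m.1) / 2) (z.1 (i - t))) +
          ∑ i ∈ B, Real.log (weight m.2 (z.2 i)))| ≤
      -Real.log (min ((1 + m.1) / 2) (1 - (1 + m.1) / 2) ^ k) := by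
  have hp : (1 + m.1) / 2 ∈ Set.Ioo (0 : ℝ) 1 := by
    constructor <;> linarith [hm₀.1, hm₀.2]
  have hm₀' := Set.Ioo_subset_Icc_self hm₀
  have hc : 0 < min ((1 + m.1) / 2) (1 - (1 + m.1) / 2) ^ k :=
    pow_pos (lt_min hp.1 (sub_pos.2 hp.2)) k
  have hA : 0 < ∏ i ∈ A, weight ((1 + m.1) / 2) (z.1 (i - t)) :=
    Finset.prod_pos fun i _ => weight_pos hp _
  have hB : 0 < ∏ i ∈ B, weight m.2 (z.2 i) :=
    Finset.prod_pos fun i hi => (weight_nonneg hm₁ _).lt_of_ne' (hz i hi)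
  have hle := le_map_phi_iterate_pinned hm₀' hm₁ (z := z) hAB
  refine ⟨(mul_pos hc (mul_pos hA hB)).trans_le hle, ?_⟩
  rw [← Real.log_prod fun i _ => (weight_pos hp _).ne', ← Real.log_prod hz,
    ← Real.log_mul hA.ne' hB.ne']
  exact abs_log_sub_log_le (mul_pos hA hB) hc hle (map_phi_iterate_pinned_le hm₀' hm₁ hAB)

lemma abs_log_map_window_sub_le (hm₀ : m.1 ∈ Set.Ioo (-1 : ℝ) 1)
    (hm₁ : m.2 ∈ Set.Icc (0 : ℝ) 1) (hz : ∀ i, weight m.2 (z.2 i) ≠ 0) (t n : ℕ) :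
    0 < ((gibbs m).map phi^[t]).real (window (phi^[t] z) n) ∧
      |Real.log (((gibbs m).map phi^[t]).real (window (phi^[t] z) n)) -
        (∑ i ∈ box n, Real.log (weight ((1 + m.1) / 2) (z.1 (i - t))) +
          ∑ i ∈ box n, Real.log (weight m.2 (z.2 i)))| ≤
      -Real.log (min ((1 + m.1) / 2) (1 - (1 + m.1) / 2) ^ t) := by
  rw [window_eq_pinned]
  exact abs_log_map_phi_iterate_pinned_sub_le hm₀ hm₁ (fun i _ => hz i)
    (card_filter_not_Ico_sub_subset_le Finset.Ico_subset_Icc_self subset_rfl t)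

lemma reversal_image_window_phi_iterate (z : Microstate) (t n : ℕ) :
    reversal '' window (phi^[t] z) n =
      pinned ((box n).map (Equiv.neg ℤ).toEmbedding)
        ((box n).map ((Equiv.neg ℤ).trans (Equiv.subRight 1)).toEmbedding)
        (phi^[t] (reversal (phi^[2 * t] z))) := by
  rw [reversal_image_window, phi_iterate_reversal_phi_iterate_two_mul]

lemma Ico_subset_map_box (n : ℕ) : Finset.Ico (-(((n + 1) / 2 : ℕ) : ℤ)) ((n / 2 : ℕ) : ℤ) ⊆
    (box n).map ((Equiv.neg ℤ).trans (Equiv.subRight 1)).toEmbedding := fun i hi => by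
  rw [Finset.mem_Ico] at hi
  refine Finset.mem_map.2 ⟨-i - 1, ?_, ?_⟩
  · rw [box, Finset.mem_Ico]; omega
  · simp

lemma map_neg_box_subset_Icc (n : ℕ) : (box n).map (Equiv.neg ℤ).toEmbedding ⊆
    Finset.Icc (-(((n + 1) / 2 : ℕ) : ℤ)) ((n / 2 : ℕ) : ℤ) := fun i hi => by
  obtain ⟨j, hj, rfl⟩ := Finset.mem_map.1 hi
  rw [box, Finset.mem_Ico] at hj
  rw [Finset.mem_Icc, Equiv.coe_toEmbedding, Equiv.neg_apply]
  omega

lemma abs_log_map_reversal_image_window_sub_le (hm₀ : m.1 ∈ Set.Ioo (-1 : ℝ) 1)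
    (hm₁ : m.2 ∈ Set.Icc (0 : ℝ) 1) (hz : ∀ i, weight m.2 (z.2 i) ≠ 0) (t n : ℕ) :
    0 < ((gibbs m).map phi^[t]).real (reversal '' window (phi^[t] z) n) ∧
      |Real.log (((gibbs m).map phi^[t]).real (reversal '' window (phi^[t] z) n)) -
        (∑ i ∈ box n, Real.log (weight ((1 + m.1) / 2) ((phi^[2 * t] z).1 (i + t))) +
          ∑ i ∈ box n, Real.log (weight m.2 (z.2 i)))| ≤
      -Real.log (min ((1 + m.1) / 2) (1 - (1 + m.1) / 2) ^ t) := by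
  have hscatterer (i : ℤ) : (reversal (phi^[2 * t] z)).2 i = z.2 (-i - 1) := by
    rw [reversal, phi_iterate_snd]
  have hbound := abs_log_map_phi_iterate_pinned_sub_le (z := reversal (phi^[2 * t] z)) hm₀ hm₁
    (fun i _ => by rw [hscatterer]; exact hz _)
    (card_filter_not_Ico_sub_subset_le (map_neg_box_subset_Icc n) (Ico_subset_map_box n) t)
  rw [← reversal_image_window_phi_iterate] at hbound
  simpa [Finset.sum_map, reversal, phi_iterate_snd, add_comm] using hbound

lemma IsMLRandomState.tendsto_log_window_sub_log_reversal (hm₀ : m.1 ∈ Set.Ioo (-1 : ℝ) 1)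
    (hm₁ : m.2 ∈ Set.Icc (0 : ℝ) 1) (hz : IsMLRandomState (gibbs m) z) (t : ℕ) :
    Tendsto (fun n : ℕ =>
        (Real.log (((gibbs m).map phi^[t]).real (window (phi^[t] z) n)) -
          Real.log (((gibbs m).map phi^[t]).real (reversal '' window (phi^[t] z) n))) / n) atTop
      (𝓝 ((1 - (1 - 2 * m.2) ^ (2 * t)) / 2 *
        (m.1 * Real.log ((1 + m.1) / (1 - m.1))))) := by
  have hm₀' := Set.Ioo_subset_Icc_self hm₀
  have hz' := hz.weight_scatterer_ne_zero hm₁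
  have hsums := (hz.tendsto_average_log_weight hm₀' hm₁ ((1 + m.1) / 2) 0 (-t)).sub
    (hz.tendsto_average_log_weight hm₀' hm₁ ((1 + m.1) / 2) (2 * t) t)
  simp only [← sub_div, Function.iterate_zero, id_eq, ← sub_eq_add_neg] at hsums
  have hlog : Real.log ((1 + m.1) / (1 - m.1)) =
      Real.log ((1 + m.1) / 2) - Real.log (1 - (1 + m.1) / 2) := by
    rw [← Real.log_div (by linarith [hm₀.1]) (by linarith [hm₀.2])]
    congr 1
    grind
  have hclose (n : ℕ) := add_le_add (abs_log_map_window_sub_le hm₀ hm₁ hz' t n).2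
    (abs_log_map_reversal_image_window_sub_le hm₀ hm₁ hz' t n).2
  refine tendsto_div_of_abs_sub_le
    (fun n => (le_of_eq ?_).trans ((norm_sub_le (E := ℝ) _ _).trans (hclose n)))
    (hsums.mono_right (congrArg 𝓝 ?_).le)
  · rw [Real.norm_eq_abs]
    congr 1
    ring
  · rw [hlog]
    ring

lemma IsMLRandomState.infoLoss_eq (hm₀ : m.1 ∈ Set.Ioo (-1 : ℝ) 1)
    (hm₁ : m.2 ∈ Set.Icc (0 : ℝ) 1) (hz : IsMLRandomState (gibbs m) z) (t : ℕ) :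
    infoLoss (gibbs m) t z = (((1 - (1 - 2 * m.2) ^ (2 * t)) / 2 *
      (m.1 * Real.log ((1 + m.1) / (1 - m.1))) : ℝ) : EReal) := by
  refine Tendsto.limsup_eq (((continuous_coe_real_ereal.tendsto _).comp
    (hz.tendsto_log_window_sub_log_reversal hm₀ hm₁ t)).congr fun n => ?_)
  have hz' := hz.weight_scatterer_ne_zero hm₁
  obtain ⟨hwindow, -⟩ := abs_log_map_window_sub_le hm₀ hm₁ hz' t n
  obtain ⟨hreversal, -⟩ := abs_log_map_reversal_image_window_sub_le hm₀ hm₁ hz' t n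
  have hratio := div_pos hreversal hwindow
  rw [measureReal_def, measureReal_def, ← ENNReal.toReal_div] at hratio
  rw [Function.comp_apply, ENNReal.log_pos_real' hratio, ENNReal.toReal_div, ← measureReal_def,
    ← measureReal_def, Real.log_div hreversal.ne' hwindow.ne', ← EReal.coe_mul]
  congr 1
  ring

lemma eq_of_weight_ne_zero {p : ℝ} (hp : p = 0 ∨ p = 1) {a b : Bool} (ha : weight p a ≠ 0)
    (hb : weight p b ≠ 0) : a = b := by
  rcases hp with rfl | rfl <;> cases a <;> cases b <;> simp [weight] at ha hb ⊢

lemma ae_eq_of_weight_ne_zero {p : ℝ} (hp : p = 0 ∨ p = 1) {y' : Config}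
    (hy' : ∀ i, weight p (y' i) ≠ 0) : ∀ᵐ y ∂bernoulliConfig p, y = y' := by
  have hp' : p ∈ Set.Icc (0 : ℝ) 1 := by rcases hp with rfl | rfl <;> simp
  simp only [funext_iff]
  refine ae_all_iff.2 fun i => ae_iff.2 ?_
  simp only [← ne_eq, ← Bool.eq_not, bernoulliConfig_setOf_apply_eq hp', ENNReal.ofReal_eq_zero]
  by_contra! hpos
  simpa using eq_of_weight_ne_zero hp hpos.ne' (hy' i)

lemma ae_scattering_eq {p : ℝ} (h : t = 0 ∨ p = 0 ∨ p = 1) {y' : Config}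
    (hy' : ∀ i, weight p (y' i) ≠ 0) :
    ∀ᵐ y ∂bernoulliConfig p, scattering y t = scattering y' t := by
  rcases h with rfl | hp
  · exact ae_of_all _ fun _ => rfl
  · exact (ae_eq_of_weight_ne_zero hp hy').mono fun y hy => by rw [hy]

lemma scattering_two_mul_eq_false {p : ℝ} (h : t = 0 ∨ p = 0 ∨ p = 1) {y : Config}
    (hy : ∀ i, weight p (y i) ≠ 0) (i : ℤ) : scattering y (2 * t) i = false := by
  rcases h with rfl | hp
  · rfl
  · have hconst (a : ℤ) : y a = y 0 := eq_of_weight_ne_zero hp (hy a) (hy 0)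
    induction t generalizing i with
    | zero => rfl
    | succ t ih => simp [mul_add, scattering, ih, hconst]

lemma IsMLRandomState.map_reversal_image_window_eq (hm₀ : m.1 ∈ Set.Icc (-1 : ℝ) 1)
    (hm₁ : m.2 ∈ Set.Icc (0 : ℝ) 1) (h : t = 0 ∨ m.2 = 0 ∨ m.2 = 1)
    (hz : IsMLRandomState (gibbs m) z) (n : ℕ) :
    (gibbs m).map phi^[t] (reversal '' window (phi^[t] z) n) =
      (gibbs m).map phi^[t] (window (phi^[t] z) n) := by
  have hy := hz.weight_scatterer_ne_zero hm₁
  have hflip := scattering_two_mul_eq_false h hy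
  have hae := ae_scattering_eq h (y' := (reversal (phi^[2 * t] z)).2) fun i => by
    simpa only [reversal, phi_iterate_snd] using hy (-i - 1)
  rw [reversal_image_window_phi_iterate, window_eq_pinned,
    map_phi_iterate_pinned_of_ae_scattering_eq hm₀ hm₁ hae,
    map_phi_iterate_pinned_of_ae_scattering_eq hm₀ hm₁ (ae_scattering_eq h hy)]
  have hsite (i : ℤ) : (t : ℤ) + i - 2 * t = i - t := by ring
  simp [Finset.prod_map, reversal, phi_iterate, hflip, hsite]

lemma IsMLRandomState.infoLoss_eq_zero (hm₀ : m.1 ∈ Set.Icc (-1 : ℝ) 1)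
    (hm₁ : m.2 ∈ Set.Icc (0 : ℝ) 1) (h : t = 0 ∨ m.2 = 0 ∨ m.2 = 1)
    (hz : IsMLRandomState (gibbs m) z) : infoLoss (gibbs m) t z = 0 := by
  have hp := half_one_add_mem_Icc hm₀
  have hwindow (n : ℕ) : (gibbs m).map phi^[t] (window (phi^[t] z) n) ≠ 0 := by
    rw [window_eq_pinned, map_phi_iterate_pinned_of_ae_scattering_eq hm₀ hm₁
      (ae_scattering_eq h (hz.weight_scatterer_ne_zero hm₁)),
      ← ENNReal.ofReal_mul (Finset.prod_nonneg fun i _ => weight_nonneg hp _)]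
    refine (ENNReal.ofReal_pos.2 (mul_pos (Finset.prod_pos fun i _ => ?_)
      (Finset.prod_pos fun i _ => ?_))).ne'
    · exact (weight_nonneg hp _).lt_of_ne' (hz.weight_spin_ne_zero hm₀ _)
    · exact (weight_nonneg hm₁ _).lt_of_ne' (hz.weight_scatterer_ne_zero hm₁ _)
  simp only [infoLoss, hz.map_reversal_image_window_eq hm₀ hm₁ h,
    ENNReal.div_self (hwindow _) (measure_ne_top _ _), ENNReal.log_one, mul_zero, limsup_const]

lemma abs_one_sub_two_mul_pow_lt_one {q : ℝ} (hq : q ∈ Set.Ioo (0 : ℝ) 1) {t : ℕ} (ht : t ≠ 0) :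
    |(1 - 2 * q) ^ t| < 1 := by
  rw [abs_pow]
  exact pow_lt_one₀ (abs_nonneg _) (abs_lt.2 ⟨by linarith [hq.2], by linarith [hq.1]⟩) ht

lemma IsMLRandomState.exists_weight_phi_iterate_eq_zero (hm₀ : m.1 = -1 ∨ m.1 = 1)
    (hm₁ : m.2 ∈ Set.Ioo (0 : ℝ) 1) (ht : t ≠ 0) (hz : IsMLRandomState (gibbs m) z) :
    ∃ i, weight ((1 + m.1) / 2) ((phi^[t] z).1 i) = 0 := by
  have hm₀' : m.1 ∈ Set.Icc (-1 : ℝ) 1 := by rcases hm₀ with h | h <;> simp [h]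
  have hp : (1 + m.1) / 2 = 0 ∨ (1 + m.1) / 2 = 1 := by
    rcases hm₀ with h | h <;> norm_num [h]
  have hm₁' := Set.Ioo_subset_Icc_self hm₁
  by_contra! hne
  have hsame (i : ℤ) : (phi^[t] z).1 i = z.1 i :=
    eq_of_weight_ne_zero hp (hne i) (hz.weight_spin_ne_zero hm₀' i)
  have hlimit := tendsto_nhds_unique (hz.tendsto_average_sgn hm₀' hm₁' t 0)
    (by simpa only [hsame, Function.iterate_zero, id_eq] using hz.tendsto_average_sgn hm₀' hm₁' 0 0)
  have hpow : |(1 - 2 * m.2) ^ t| = 1 := by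
    rcases hm₀ with h | h <;> simpa [h] using congrArg abs hlimit
  exact (abs_one_sub_two_mul_pow_lt_one hm₁ ht).ne hpow

lemma IsMLRandomState.infoLoss_eq_top (hm₀ : m.1 = -1 ∨ m.1 = 1)
    (hm₁ : m.2 ∈ Set.Ioo (0 : ℝ) 1) (ht : t ≠ 0) (hz : IsMLRandomState (gibbs m) z) :
    infoLoss (gibbs m) t z = ⊤ := by
  have hm₀' : m.1 ∈ Set.Icc (-1 : ℝ) 1 := by rcases hm₀ with h | h <;> simp [h]
  obtain ⟨i, hi⟩ := hz.exists_weight_phi_iterate_eq_zero hm₀ hm₁ (mul_ne_zero two_ne_zero ht)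
  refine (limsup_congr (v := fun _ => (⊤ : EReal)) ?_).trans (limsup_const _)
  filter_upwards [eventually_ge_atTop (2 * (i.natAbs + t) + 2)] with n hn
  have hreversal : (gibbs m).map phi^[t] (reversal '' window (phi^[t] z) n) = 0 := by
    rw [reversal_image_window_phi_iterate]
    refine map_phi_iterate_pinned_eq_zero hm₀' (i := t - i) ?_ ?_ ?_
    · exact Finset.mem_map.2 ⟨i - t, by rw [box, Finset.mem_Ico]; omega, by simp⟩
    · exact (Finset.Ico_subset_Ico (by omega) (by omega)).trans (Ico_subset_map_box n)
    · simpa [reversal] using hi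
  have hn' : (0 : ℝ) < n := by exact_mod_cast (by omega)
  rw [hreversal, ENNReal.zero_div, ENNReal.log_zero]
  exact EReal.coe_mul_bot_of_neg (by rw [neg_lt_zero]; positivity)

end InfoLoss

/-! ### Comparison with the Boltzmann entropy -/

lemma lt_add_mul_sub_of_strictConcaveOn {S : Set ℝ} {f : ℝ → ℝ} {f' x y : ℝ}
    (hf : StrictConcaveOn ℝ S f) (hx : x ∈ S) (hy : y ∈ S) (hxy : y ≠ x)
    (hf' : HasDerivAt f f' x) : f y < f x + f' * (y - x) := by
  rcases hxy.lt_or_gt with h | h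
  · have hslope := hf.lt_slope_of_hasDerivAt hy hx h hf'
    rw [slope_def_field, lt_div_iff₀ (sub_pos.2 h)] at hslope
    linarith
  · have hslope := hf.slope_lt_of_hasDerivAt hx hy h hf'
    rw [slope_def_field, div_lt_iff₀ (sub_pos.2 h)] at hslope
    linarith

lemma binEntropy_one_add_abs_mul_div_two (r x : ℝ) :
    Real.binEntropy ((1 + |r| * x) / 2) = Real.binEntropy ((1 + r * x) / 2) := by
  rcases abs_choice r with h | h
  · rw [h]
  · rw [h, ← Real.binEntropy_one_sub]
    congr 1
    ring

lemma mul_log_div_pos {x : ℝ} (hx : x ∈ Set.Ioo (-1 : ℝ) 1) (hx₀ : x ≠ 0) :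
    0 < x * Real.log ((1 + x) / (1 - x)) := by
  have hpos : 0 < 1 - x := sub_pos.2 hx.2
  rcases hx₀.lt_or_gt with h | h
  · refine mul_pos_of_neg_of_neg h (Real.log_neg (div_pos (by linarith [hx.1]) hpos) ?_)
    rw [div_lt_one hpos]
    linarith
  · refine mul_pos h (Real.log_pos ?_)
    rw [one_lt_div hpos]
    linarith

lemma hasDerivAt_binEntropy_one_add_div_two {x : ℝ} (hx : x ∈ Set.Ioo (-1 : ℝ) 1) :
    HasDerivAt Real.binEntropy (-Real.log ((1 + x) / (1 - x))) ((1 + x) / 2) := by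
  have h₁ : 0 < 1 + x := by linarith [hx.1]
  have h₂ : 0 < 1 - x := by linarith [hx.2]
  have h := Real.hasDerivAt_binEntropy (p := (1 + x) / 2) (by positivity) (by linarith)
  rwa [show 1 - (1 + x) / 2 = (1 - x) / 2 by ring, ← Real.log_div (by positivity) (by positivity),
    div_div_div_cancel_right₀ two_ne_zero, ← inv_div, Real.log_inv] at h

lemma binEntropy_sub_binEntropy_lt {x r : ℝ} (hx : x ∈ Set.Ioo (-1 : ℝ) 1) (hx₀ : x ≠ 0)
    (hr : |r| < 1) :
    Real.binEntropy ((1 + r * x) / 2) - Real.binEntropy ((1 + x) / 2) <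
      (1 - r ^ 2) / 2 * (x * Real.log ((1 + x) / (1 - x))) := by
  rw [← binEntropy_one_add_abs_mul_div_two, ← sq_abs r]
  have hr₀ := abs_nonneg r
  generalize |r| = s at hr hr₀
  have hmem : (1 + s * x) / 2 ∈ Set.Icc (0 : ℝ) 1 := by
    constructor <;> nlinarith [hx.1, hx.2]
  have hne : (1 + s * x) / 2 ≠ (1 + x) / 2 := fun h =>
    mul_ne_zero (sub_pos.2 hr).ne' hx₀ (by linarith)
  have htangent := lt_add_mul_sub_of_strictConcaveOn Real.strictConcave_binEntropy
    ⟨by linarith [hx.1], by linarith [hx.2]⟩ hmem hne (hasDerivAt_binEntropy_one_add_div_two hx)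
  calc Real.binEntropy ((1 + s * x) / 2) - Real.binEntropy ((1 + x) / 2)
      < (1 - s) / 2 * (x * Real.log ((1 + x) / (1 - x))) := by linarith
    _ ≤ (1 - s ^ 2) / 2 * (x * Real.log ((1 + x) / (1 - x))) := by
      have := (mul_log_div_pos hx hx₀).le
      gcongr
      nlinarith

lemma Phi_iterate (m : ℝ × ℝ) (t : ℕ) : Phi^[t] m = ((1 - 2 * m.2) ^ t * m.1, m.2) := by
  induction t with
  | zero => simp
  | succ t ih =>
    rw [Function.iterate_succ_apply', ih, Phi, pow_succ', mul_assoc]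

lemma Phi_iterate_fst_mem_Icc {m : ℝ × ℝ} (hm₀ : m.1 ∈ Set.Icc (-1 : ℝ) 1)
    (hm₁ : m.2 ∈ Set.Icc (0 : ℝ) 1) (t : ℕ) : (Phi^[t] m).1 ∈ Set.Icc (-1 : ℝ) 1 := by
  have hr : |1 - 2 * m.2| ≤ 1 := abs_le.2 ⟨by linarith [hm₁.2], by linarith [hm₁.1]⟩
  rw [Phi_iterate, Set.mem_Icc, ← abs_le, abs_mul, abs_pow]
  exact mul_le_one₀ (pow_le_one₀ (abs_nonneg _) hr) (abs_nonneg _) (abs_le.2 hm₀)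

lemma boltzmannEntropy_Phi_iterate_sub (m : ℝ × ℝ) (t : ℕ) :
    boltzmannEntropy (Phi^[t] m) - boltzmannEntropy m =
      Real.binEntropy ((1 + (1 - 2 * m.2) ^ t * m.1) / 2) - Real.binEntropy ((1 + m.1) / 2) := by
  rw [boltzmannEntropy, boltzmannEntropy, Phi_iterate]
  ring

section EntropyGain

variable {m : ℝ × ℝ} {z : Microstate} {t : ℕ}

theorem IsMLRandomState.infoLoss_pos (hm₀ : m.1 ∈ Set.Icc (-1 : ℝ) 1) (hm : m.1 ≠ 0)
    (hm₁ : m.2 ∈ Set.Ioo (0 : ℝ) 1) (ht : t ≠ 0) (hz : IsMLRandomState (gibbs m) z) :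
    0 < infoLoss (gibbs m) t z := by
  rcases Set.eq_endpoints_or_mem_Ioo_of_mem_Icc hm₀ with h | h | h
  · simp [hz.infoLoss_eq_top (.inl h) hm₁ ht]
  · simp [hz.infoLoss_eq_top (.inr h) hm₁ ht]
  · rw [IsMLRandomState.infoLoss_eq h (Set.Ioo_subset_Icc_self hm₁) hz]
    have hr := (sq_lt_one_iff_abs_lt_one _).2 (abs_one_sub_two_mul_pow_lt_one hm₁ ht)
    rw [mul_comm 2 t, pow_mul]
    exact EReal.coe_pos.2 (mul_pos (half_pos (sub_pos.2 hr)) (mul_log_div_pos h hm))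

theorem IsMLRandomState.boltzmannEntropy_sub_lt_infoLoss (hm₀ : m.1 ∈ Set.Icc (-1 : ℝ) 1)
    (hm : m.1 ≠ 0) (hm₁ : m.2 ∈ Set.Ioo (0 : ℝ) 1) (ht : t ≠ 0)
    (hz : IsMLRandomState (gibbs m) z) :
    ((boltzmannEntropy (Phi^[t] m) - boltzmannEntropy m : ℝ) : EReal) <
      infoLoss (gibbs m) t z := by
  rcases Set.eq_endpoints_or_mem_Ioo_of_mem_Icc hm₀ with h | h | h
  · rw [hz.infoLoss_eq_top (.inl h) hm₁ ht]
    exact EReal.coe_lt_top _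
  · rw [hz.infoLoss_eq_top (.inr h) hm₁ ht]
    exact EReal.coe_lt_top _
  · rw [IsMLRandomState.infoLoss_eq h (Set.Ioo_subset_Icc_self hm₁) hz,
      boltzmannEntropy_Phi_iterate_sub, EReal.coe_lt_coe_iff, mul_comm 2 t, pow_mul]
    exact binEntropy_sub_binEntropy_lt h hm (abs_one_sub_two_mul_pow_lt_one hm₁ ht)

theorem IsMLRandomState.boltzmannEntropy_sub_eq_infoLoss (hm₀ : m.1 ∈ Set.Icc (-1 : ℝ) 1)
    (hm₁ : m.2 ∈ Set.Icc (0 : ℝ) 1) (h : m.1 = 0 ∨ m.2 = 0 ∨ m.2 = 1 ∨ t = 0)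
    (hz : IsMLRandomState (gibbs m) z) :
    ((boltzmannEntropy (Phi^[t] m) - boltzmannEntropy m : ℝ) : EReal) =
      infoLoss (gibbs m) t z := by
  rw [boltzmannEntropy_Phi_iterate_sub]
  rcases h with h | h
  · rw [IsMLRandomState.infoLoss_eq (by norm_num [h]) hm₁ hz, h]
    simp
  · have habs : |(1 - 2 * m.2) ^ t| = 1 := by
      rw [abs_pow]
      rcases h with h | h | rfl
      · simp [h]
      · norm_num [h]
      · simp
    rw [hz.infoLoss_eq_zero hm₀ hm₁ (by tauto), ← binEntropy_one_add_abs_mul_div_two, habs,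
      one_mul, sub_self, EReal.coe_zero]

end EntropyGain

end KacChain

theorem mainTheorem5_general (m₀ m₁ : ℝ) (hm₀ : m₀ ∈ Set.Icc (-1 : ℝ) 1)
    (hm₁ : m₁ ∈ Set.Icc (0 : ℝ) 1) (z : KacChain.Microstate)
    (hz : KacChain.IsMLRandomState (KacChain.gibbs (m₀, m₁)) z) (t : ℕ) :
    (-1 < m₀ → m₀ < 1 →
      KacChain.infoLoss (KacChain.gibbs (m₀, m₁)) t z =
        (((1 - (1 - 2 * m₁) ^ (2 * t)) / 2 * (m₀ * Real.log ((1 + m₀) / (1 - m₀))) : ℝ) : EReal)) ∧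
    (m₀ ≠ 0 → m₁ ≠ 0 → m₁ ≠ 1 → 0 < t →
      0 < KacChain.infoLoss (KacChain.gibbs (m₀, m₁)) t z) ∧
    ∃ S₀ Sₜ : ℝ,
      KacChain.HasBoltzmannEntropy (m₀, m₁) (S₀ : EReal) ∧
      KacChain.HasBoltzmannEntropy (KacChain.Phi^[t] (m₀, m₁)) (Sₜ : EReal) ∧
      ((Sₜ - S₀ : ℝ) : EReal) ≤ KacChain.infoLoss (KacChain.gibbs (m₀, m₁)) t z ∧
      (((Sₜ - S₀ : ℝ) : EReal) = KacChain.infoLoss (KacChain.gibbs (m₀, m₁)) t z ↔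
        m₀ = 0 ∨ m₁ = 0 ∨ m₁ = 1 ∨ t = 0) := by
  have hΦ := KacChain.Phi_iterate_fst_mem_Icc (m := (m₀, m₁)) hm₀ hm₁ t
  have hΦ_snd : (KacChain.Phi^[t] (m₀, m₁)).2 = m₁ := by rw [KacChain.Phi_iterate]
  have hIoo (h₀ : m₁ ≠ 0) (h₁ : m₁ ≠ 1) : m₁ ∈ Set.Ioo (0 : ℝ) 1 :=
    ⟨hm₁.1.lt_of_ne' h₀, hm₁.2.lt_of_ne h₁⟩
  refine ⟨fun h h' => KacChain.IsMLRandomState.infoLoss_eq (m := (m₀, m₁)) ⟨h, h'⟩ hm₁ hz t,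
    fun h h₀ h₁ ht => hz.infoLoss_pos hm₀ h (hIoo h₀ h₁) ht.ne',
    KacChain.boltzmannEntropy (m₀, m₁), KacChain.boltzmannEntropy (KacChain.Phi^[t] (m₀, m₁)),
    KacChain.hasBoltzmannEntropy (m := (m₀, m₁)) hm₀ hm₁,
    KacChain.hasBoltzmannEntropy hΦ (hΦ_snd.symm ▸ hm₁), ?_⟩
  by_cases hdeg : m₀ = 0 ∨ m₁ = 0 ∨ m₁ = 1 ∨ t = 0
  · have heq := hz.boltzmannEntropy_sub_eq_infoLoss hm₀ hm₁ hdeg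
    exact ⟨heq.le, iff_of_true heq hdeg⟩
  · have ⟨h, h₀, h₁, ht⟩ : m₀ ≠ 0 ∧ m₁ ≠ 0 ∧ m₁ ≠ 1 ∧ t ≠ 0 := by simpa only [not_or] using hdeg
    have hlt := hz.boltzmannEntropy_sub_lt_infoLoss hm₀ h (hIoo h₀ h₁) ht
    exact ⟨hlt.le, iff_of_false hlt.ne hdeg⟩

theorem mainTheorem5 (m₀ m₁ : ℝ) (hm₀ : m₀ ∈ Set.Icc (-1 : ℝ) 1) (hm₁ : m₁ ∈ Set.Icc (0 : ℝ) 1)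
    (hc₀ : KacChain.ComputableReal m₀) (hc₁ : KacChain.ComputableReal m₁)
    (z : KacChain.Microstate)
    (hz : KacChain.IsMLRandomState (KacChain.gibbs (m₀, m₁)) z) (t : ℕ) :
    (-1 < m₀ → m₀ < 1 →
      KacChain.infoLoss (KacChain.gibbs (m₀, m₁)) t z =
        (((1 - (1 - 2 * m₁) ^ (2 * t)) / 2 * (m₀ * Real.log ((1 + m₀) / (1 - m₀))) : ℝ) : EReal)) ∧
    (m₀ ≠ 0 → m₁ ≠ 0 → m₁ ≠ 1 → 0 < t →
      0 < KacChain.infoLoss (KacChain.gibbs (m₀, m₁)) t z) ∧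
    ∃ S₀ Sₜ : ℝ,
      KacChain.HasBoltzmannEntropy (m₀, m₁) (S₀ : EReal) ∧
      KacChain.HasBoltzmannEntropy (KacChain.Phi^[t] (m₀, m₁)) (Sₜ : EReal) ∧
      ((Sₜ - S₀ : ℝ) : EReal) ≤ KacChain.infoLoss (KacChain.gibbs (m₀, m₁)) t z ∧
      (((Sₜ - S₀ : ℝ) : EReal) = KacChain.infoLoss (KacChain.gibbs (m₀, m₁)) t z ↔
        m₀ = 0 ∨ m₁ = 0 ∨ m₁ = 1 ∨ t = 0) :=
  mainTheorem5_general m₀ m₁ hm₀ hm₁ z hz t
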